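/- **Setting.** Let $a=x_0<x_1<\dots<x_q<x_{q+1}=b$, let $d_0,\dots,d_q\ge 0$ be integers (degrees on $[x_i,x_{i+1}]$) and let $k_1,\dots,k_q\ge 0$ be integers with $k_i\le\min(d_{i-1},d_i)$ (continuities at $x_i$). These data determine the multi-degree spline space $\mathcal S$ of functions on $[a,b]$ that are polynomials of degree at most $d_i$ on $[x_i,x_{i+1}]$ and $C^{k_i}$ at $x_i$. Put $m=\max_i d_i$ and $K=d_0+1+\sum_{i=1}^q(d_i-k_i)$. The left extended partition $(s_i)_{i=1}^K$ consists of $a$ repeated $d_0+1$ times followed by $x_i$ repeated $d_i-k_i$ times, $i=1,\dots,q$; the right one $(t_i)_{i=1}^K$ consists of $x_i$ repeated $d_{i-1}-k_i$ times, $i=1,\dots,q$, followed by $b$ repeated $d_q+1$ times. For $n=0,\dots,m$ and $i=m+1-n,\dots,K$ with $s_i<t_{i-m+n}$, the function $N_{i,n}$ vanishes outside $[s_i,t_{i-m+n}]$ and on each breakpoint interval $[x_j,x_{j+1})\subset[s_i,t_{i-m+n}]$ (closed at $b$ if $j=q$) $$N_{i,n}(x)=\begin{cases}1,& n=m-d_j,\\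 \int_{-\infty}^x\big(\delta_{i,n-1}N_{i,n-1}(u)-\delta_{i+1,n-1}N_{i+1,n-1}(u)\big)\,du,& n>m-d_j,\\ 0,&n<m-d_j,\end{cases}\qquad \delta_{i,n}=\Big(\int_{-\infty}^{\infty}N_{i,n}\Big)^{-1}.$$ For all other $(i,n)$ one puts $N_{i,n}=0$ and reads $\int_{-\infty}^x\delta_{i,n}N_{i,n}(u)\,du$ as $0$ for $x<s_i$ and $1$ for $x\ge s_i$ (with $s_{K+1}=+\infty$). The MDB-spline basis of $\mathcal S$ is $N_i=N_{i,m}$, $1\le i\le K$, and that of the space $D\mathcal S$ of right derivatives is $N_i^{(1)}=N_{i+1,m-1}$, $1\le i\le K-1$. Fix $j\in\{1,\dots,q\}$ with $k_j\ge1$, and let $\widehat{\mathcal S}$ be the space with the same breakpoints, degrees and continuities except that $k_j$ is replaced by $k_j-1$; denote by $\hat N_i$, $\hat N_i^{(1)}$ the bases of $\widehat{\mathcal S}$, $D\widehat{\mathcal S}$. The reverse-knot-insertion coefficients $\alpha_1,\dots,\alpha_{K+1}$ from $\widehat{\mathcal S}$ to $\mathcal S$, and $\alpha^{(1)}_1,\dots,\alpha^{(1)}_K$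 from $D\widehat{\mathcal S}$ to $D\mathcal S$, are the numbers such that, on $[a,b]$, $$N_i=\alpha_i\hat N_i+(1-\alpha_{i+1})\hat N_{i+1}\ (1\le i\le K),\qquad N^{(1)}_i=\alpha^{(1)}_i\hat N^{(1)}_i+(1-\alpha^{(1)}_{i+1})\hat N^{(1)}_{i+1}\ (1\le i\le K-1).$$ Let $\ell\in\{1,\dots,K\}$ be the index with $s_\ell\le x_j<\min(s_{\ell+1},b)$, where $s_{K+1}$ is read as $b$ in this condition. **Proposition.** Such coefficients $\alpha_i$ and $\alpha_i^{(1)}$ exist, and all such coefficients satisfy, for $i=\ell-d_j+1,\dots,\ell-d_j+k_j$, $\int_a^bN_{i-1}^{(1)}(x)\,dx>0$ and $$\alpha_i=\alpha_{i-1}^{(1)}\,\frac{\int_a^b\hat N_{i-1}^{(1)}(x)\,dx}{\int_a^bN_{i-1}^{(1)}(x)\,dx},\qquad 1-\alpha_i=(1-\alpha_i^{(1)})\,\frac{\int_a^b\hat N_i^{(1)}(x)\,dx}{\int_a^bN_{i-1}^{(1)}(x)\,dx}.$$ Moreover, if $k_j=1$, then every $\alpha_i^{(1)}$, $1\le i\le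 K$, is $0$ or $1$. -/

import Mathlib

open MeasureTheory Set

noncomputable section

/-- The data of a multi-degree spline space on `[a, b]`: a partition
`a = x 0 < x 1 < ... < x q < x (q + 1) = b`, degrees `d 0, ..., d q` (with `d i` the degree on
`[x i, x (i + 1)]`) and continuities `k 1, ..., k q` (with `k i` the order of continuity at `x i`).
Values of `x`, `d`, `k` at other indices are irrelevant. -/
structure MDSpline where
  q : ℕ
  x : ℕ → ℝ
  d : ℕ → ℕ
  k : ℕ → ℕ
  x_lt : ∀ i ≤ q, x i < x (i + 1)
  k_le : ∀ i, 1 ≤ i → i ≤ q → k i ≤ min (d (i - 1)) (d i)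

namespace MDSpline

variable (S : MDSpline)

/-- Left end point of the interval. -/
def a : ℝ := S.x 0

/-- Right end point of the interval. -/
def b : ℝ := S.x (S.q + 1)

/-- The maximal degree. -/
def m : ℕ := (Finset.range (S.q + 1)).sup S.d

/-- The dimension of the space. -/
def K : ℕ := S.d 0 + 1 + ∑ i ∈ Finset.Icc 1 S.q, (S.d i - S.k i)

/-- The left extended partition, as a list of length `K`: `a` repeated `d 0 + 1` times, followed by
`x i` repeated `d i - k i` times for `i = 1, ..., q`. -/
def leftList : List ℝ :=
  List.replicate (S.d 0 + 1) S.a ++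
    (List.range S.q).flatMap fun i => List.replicate (S.d (i + 1) - S.k (i + 1)) (S.x (i + 1))

/-- The right extended partition, as a list of length `K`: `x i` repeated `d (i - 1) - k i` times
for `i = 1, ..., q`, followed by `b` repeated `d q + 1` times. -/
def rightList : List ℝ :=
  ((List.range S.q).flatMap fun i => List.replicate (S.d i - S.k (i + 1)) (S.x (i + 1))) ++
    List.replicate (S.d S.q + 1) S.b

/-- The entry `s_i` of the left extended partition, `1 ≤ i ≤ K` (and `b` for `i > K`). -/
def s (i : ℕ) : ℝ := S.leftList.getD (i - 1) S.b

/-- The entry `t_i` of the right extended partition, `1 ≤ i ≤ K`. -/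
def t (i : ℕ) : ℝ := S.rightList.getD (i - 1) S.b

/-- The breakpoint interval `[x j, x (j + 1))`; the last one is closed on the right, so that the
pieces `j = 0, ..., q` partition `[a, b]`. -/
def piece (j : ℕ) : Set ℝ :=
  if j = S.q then Icc (S.x j) (S.x (j + 1)) else Ico (S.x j) (S.x (j + 1))

/-- The index `i` is admissible at level `n` (that is `m + 1 - n ≤ i ≤ K`) and the interval
`[s_i, t_{i - m + n}]` is nontrivial; otherwise the function `N_{i,n}` is undefined. -/
def IsDefined (n i : ℕ) : Prop :=
  S.m + 1 ≤ i + n ∧ i ≤ S.K ∧ S.s i < S.t (i + n - S.m)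

open Classical in
/-- The normalised primitive `x ↦ ∫_{-∞}^x δ_{i,n} N_{i,n}(u) du` of a function `f = N_{i,n}`, with
`δ_{i,n} = (∫_{-∞}^∞ N_{i,n})⁻¹`. If `N_{i,n}` is undefined, it is by convention the step function
`0` for `x < s_i`, `1` for `x ≥ s_i`, where `s_{K + 1}` is read as `+∞`. -/
def primitive (n i : ℕ) (f : ℝ → ℝ) (x : ℝ) : ℝ :=
  if S.IsDefined n i then (∫ u, f u)⁻¹ * ∫ u in Iic x, f u
  else if i ≤ S.K ∧ S.s i ≤ x then 1 else 0

open Classical in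
/-- The function which on each breakpoint interval `[x j, x (j + 1)) ⊆ [s_i, t_{i - m + n}]` equals
`1` if `n = m - d j`, equals `F` if `n > m - d j`, and is `0` otherwise. It is identically zero if
`N_{i,n}` is undefined. -/
def assemble (n i : ℕ) (F : ℝ → ℝ) (x : ℝ) : ℝ :=
  if S.IsDefined n i then
    ∑ j ∈ Finset.range (S.q + 1),
      if x ∈ S.piece j ∧ S.s i ≤ S.x j ∧ S.x (j + 1) ≤ S.t (i + n - S.m) then
        if n + S.d j = S.m then 1 else if S.m < n + S.d j then F x else 0
      else 0
  else 0

/-- The functions `N_{i,n}` of the integral recurrence, written `S.N n i`. At level `n = 0` the case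
`n > m - d j` does not occur. -/
def N : ℕ → ℕ → ℝ → ℝ
  | 0, i => S.assemble 0 i fun _ => 0
  | n + 1, i => S.assemble (n + 1) i fun x =>
      S.primitive n i (N n i) x - S.primitive n (i + 1) (N n (i + 1)) x

/-- The MDB-spline basis `N_1^{(r)}, ..., N_{K-r}^{(r)}` of the space `D^r S` of `r`-th derivatives,
`N_i^{(r)} = N_{r + i, m - r}`. For `r = 0` this is the MDB-spline basis `N_{i,m}` of `S`. -/
def basis (r i : ℕ) : ℝ → ℝ := S.N (S.m - r) (r + i)

/-- The data with the continuity at the breakpoint `x j` lowered by one (used for `k j ≥ 1`). -/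
def insertKnot (j : ℕ) : MDSpline where
  q := S.q
  x := S.x
  d := S.d
  k := Function.update S.k j (S.k j - 1)
  x_lt := S.x_lt
  k_le := by
    intro i h1 h2
    by_cases h : i = j
    · subst h
      rw [Function.update_self]
      exact (Nat.sub_le _ _).trans (S.k_le i h1 h2)
    · rw [Function.update_of_ne h]
      exact S.k_le i h1 h2

/-- `α_1, ..., α_{K-r+1}` are coefficients of reverse knot insertion at the breakpoint `x j` from
`D^r Ŝ` to `D^r S`, where `Ŝ = S.insertKnot j`:
`N_i^{(r)} = α_i N̂_i^{(r)} + (1 - α_{i+1}) N̂_{i+1}^{(r)}` on `[a, b]` for `i = 1, ..., K - r`. -/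
def IsRKICoeff (j r : ℕ) (α : ℕ → ℝ) : Prop :=
  ∀ i, 1 ≤ i → i ≤ S.K - r → ∀ x ∈ Icc S.a S.b,
    S.basis r i x =
      α i * (S.insertKnot j).basis r i x + (1 - α (i + 1)) * (S.insertKnot j).basis r (i + 1) x

end MDSpline

end

/-! The coefficients are built level by level along the integral recurrence. If `N_{i,n} = α_i
N̂_{i,n} + (1 - α_{i+1}) N̂_{i+1,n}` for all `i`, integrating over the line and up to `x` and
dividing by the mass of `N_{i,n}` writes its normalised primitive as the affine combination of two
consecutive hatted primitives with weights `α'_i` and `1 - α'_i`, where `α'_i = α_i ∫N̂_{i,n} /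
∫N_{i,n}` (`Rki.prim_eq`). Differences of consecutive primitives then give the same identity at
level `n + 1` with coefficients `α'` (`rki_succ`). The step from level `m - 1` to level `m` is
exactly the asserted pair of formulas.

Two points need care. On pieces where level `n + 1` is not yet governed by the integral formula, the
identity forces coefficients `0` or `1`; `CoeffOne` and `rkiCoeff_eq_zero` supply them, and for `k_j
= 1` these two cases exhaust all indices at level `m - 1`. Secondly, the masses must be positive.
This is proved by induction on the sum of the continuities: if all vanish, the functions below level
`m` are Bernstein polynomials on single pieces (`N_eq_bernstein`), and raising a continuity by one
gives nonnegative combinations of nonnegative functions (`rki_aux`, `nonneg`).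

Arbitrary admissible coefficients agree with the constructed ones by local linear independence
(`eq_zero_of_sum_eq_zero`, `IsRKICoeff.eq_rkiCoeff`). -/

noncomputable section

namespace MDSpline

/-! ### Extended partitions, supports and breakpoint intervals as index inequalities. -/

section

variable (S : MDSpline)

/-- The number of entries of the left extended partition that are at most `x r`. -/
def leftCount (r : ℕ) : ℕ :=
  S.d 0 + 1 + ∑ i ∈ Finset.range r, (S.d (i + 1) - S.k (i + 1))

/-- The number of entries of the right extended partition that are at most `x r`. -/
def rightCount (r : ℕ) : ℕ :=
  ∑ i ∈ Finset.range r, (S.d i - S.k (i + 1))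

/-- The `r`-th breakpoint interval is contained in `[s_i, t_{i - m + n}]`. -/
def Active (n i r : ℕ) : Prop :=
  S.rightCount r + S.m < i + n ∧ i ≤ S.leftCount r

lemma leftCount_succ (r : ℕ) :
    S.leftCount (r + 1) = S.leftCount r + (S.d (r + 1) - S.k (r + 1)) := by
  simp [leftCount, Finset.sum_range_succ, add_assoc]

lemma rightCount_succ (r : ℕ) :
    S.rightCount (r + 1) = S.rightCount r + (S.d r - S.k (r + 1)) := by
  simp [rightCount, Finset.sum_range_succ]

lemma rightCount_zero : S.rightCount 0 = 0 := by simp [rightCount]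

lemma leftCount_mono : Monotone S.leftCount :=
  monotone_nat_of_le_succ fun r => by rw [leftCount_succ]; omega

lemma rightCount_mono : Monotone S.rightCount :=
  monotone_nat_of_le_succ fun r => by rw [rightCount_succ]; omega

lemma leftCount_pos (r : ℕ) : 1 ≤ S.leftCount r := by
  unfold leftCount; omega

lemma k_succ_le {r : ℕ} (hr : r < S.q) : S.k (r + 1) ≤ S.d r ∧ S.k (r + 1) ≤ S.d (r + 1) := by
  have := S.k_le (r + 1) (by omega) (by omega)
  simpa using this

/-- Crossing a breakpoint adds `d (r + 1) - k (r + 1)` on the left and `d r - k (r + 1)` on the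
right, so the excess changes by the jump in degree; `k ≤ min` keeps the natural subtractions exact.
This is the only link between the two counts, and it feeds almost every later index computation. -/
lemma leftCount_eq {r : ℕ} (hr : r ≤ S.q) : S.leftCount r = S.rightCount r + S.d r + 1 := by
  induction r with
  | zero => simp [leftCount, rightCount]
  | succ r ih =>
    have := ih (by omega)
    have := S.k_succ_le (r := r) (by omega)
    rw [leftCount_succ, rightCount_succ]
    omega

lemma K_eq : S.K = S.leftCount S.q := by
  unfold K leftCount
  rw [Finset.range_eq_Ico, Finset.sum_Ico_add' (fun i => S.d i - S.k i) 0 S.q 1]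
  rfl

lemma leftCount_le_K {r : ℕ} (hr : r ≤ S.q) : S.leftCount r ≤ S.K := by
  rw [K_eq]; exact S.leftCount_mono hr

lemma d_le_m {r : ℕ} (hr : r ≤ S.q) : S.d r ≤ S.m :=
  Finset.le_sup (f := S.d) (Finset.mem_range.2 (by omega))

lemma x_lt_x {i j : ℕ} (hij : i < j) (hj : j ≤ S.q + 1) : S.x i < S.x j := by
  induction j with
  | zero => omega
  | succ j ih =>
    have h := S.x_lt j (by omega)
    rcases Nat.lt_succ_iff_lt_or_eq.1 hij with h1 | rfl
    · exact (ih h1 (by omega)).trans h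
    · exact h

lemma x_le_x {i j : ℕ} (hij : i ≤ j) (hj : j ≤ S.q + 1) : S.x i ≤ S.x j := by
  rcases hij.eq_or_lt with rfl | h
  · exact le_rfl
  · exact (S.x_lt_x h hj).le

lemma x_le_x_iff {i j : ℕ} (hi : i ≤ S.q + 1) (hj : j ≤ S.q + 1) : S.x i ≤ S.x j ↔ i ≤ j := by
  refine ⟨fun h => ?_, fun h => S.x_le_x h hj⟩
  by_contra hlt
  exact absurd h (not_le.2 (S.x_lt_x (by omega) hi))

lemma length_flatMap_replicate (c : ℕ → ℕ) (y : ℕ → ℝ) (n : ℕ) :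
    ((List.range n).flatMap fun i => List.replicate (c i) (y i)).length =
      ∑ i ∈ Finset.range n, c i := by
  induction n with
  | zero => simp
  | succ n ih =>
    rw [List.range_succ, List.flatMap_append, List.length_append, ih, Finset.sum_range_succ]
    simp

lemma getD_flatMap_replicate (c : ℕ → ℕ) (y : ℕ → ℝ) (z : ℝ) {n i p : ℕ} (hi : i < n)
    (h1 : ∑ l ∈ Finset.range i, c l ≤ p) (h2 : p < ∑ l ∈ Finset.range (i + 1), c l) :
    ((List.range n).flatMap fun i => List.replicate (c i) (y i)).getD p z = y i := by
  induction n with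
  | zero => omega
  | succ n ih =>
    rw [List.range_succ, List.flatMap_append]
    rcases Nat.lt_succ_iff_lt_or_eq.1 hi with h | rfl
    · rw [List.getD_append, ih h]
      rw [length_flatMap_replicate]
      exact h2.trans_le (Finset.sum_le_sum_of_subset (Finset.range_mono h))
    · rw [List.getD_append_right _ _ _ _ (by rwa [length_flatMap_replicate]),
        length_flatMap_replicate]
      rw [Finset.sum_range_succ] at h2
      simp only [List.flatMap_cons, List.flatMap_nil, List.append_nil]
      rw [List.getD_replicate]
      omega

lemma exists_block (c : ℕ → ℕ) {n p : ℕ} (hp : p < ∑ l ∈ Finset.range n, c l) :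
    ∃ i < n, ∑ l ∈ Finset.range i, c l ≤ p ∧ p < ∑ l ∈ Finset.range (i + 1), c l := by
  induction n with
  | zero => simp at hp
  | succ n ih =>
    by_cases h : p < ∑ l ∈ Finset.range n, c l
    · obtain ⟨i, hi, h1⟩ := ih h
      exact ⟨i, by omega, h1⟩
    · exact ⟨n, by omega, not_lt.1 h, hp⟩

lemma exists_s_eq {i : ℕ} (hi : 1 ≤ i) (hK : i ≤ S.K) :
    ∃ r ≤ S.q, S.s i = S.x r ∧ i ≤ S.leftCount r ∧ ∀ r' < r, S.leftCount r' < i := by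
  -- Treating the copies of `a` as block `0` turns the whole left list into one concatenation of
  -- blocks.
  let c : ℕ → ℕ := fun r => if r = 0 then S.d 0 + 1 else S.d r - S.k r
  have hc : ∀ r, ∑ l ∈ Finset.range (r + 1), c l = S.leftCount r := by
    intro r
    rw [Finset.sum_range_succ', leftCount, add_comm]
    simp [c]
  have hlist : S.leftList = (List.range (S.q + 1)).flatMap fun r => List.replicate (c r) (S.x r) := by
    rw [List.range_succ_eq_map, List.flatMap_cons, List.flatMap_map]
    simp [leftList, c, a]
  obtain ⟨r, hr, h1, h2⟩ := exists_block c (n := S.q + 1) (p := i - 1) (by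
    rw [hc, ← K_eq]; omega)
  refine ⟨r, by omega, ?_, ?_, fun r' hr' => ?_⟩
  · rw [s, hlist, getD_flatMap_replicate c S.x S.b hr h1 h2]
  · rw [hc] at h2; omega
  · have : S.leftCount r' ≤ ∑ l ∈ Finset.range r, c l := by
      rw [← hc]
      exact Finset.sum_le_sum_of_subset (Finset.range_mono hr')
    omega

lemma exists_t_eq {i : ℕ} (hi : 1 ≤ i) (hK : i ≤ S.K) :
    ∃ r ≤ S.q, S.t i = S.x (r + 1) ∧ S.rightCount r < i ∧
      ∀ r', r < r' → r' ≤ S.q → i ≤ S.rightCount r' := by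
  let c : ℕ → ℕ := fun r => if r = S.q then S.d S.q + 1 else S.d r - S.k (r + 1)
  have hc : ∀ r ≤ S.q, ∑ l ∈ Finset.range r, c l = S.rightCount r := by
    intro r hr
    refine Finset.sum_congr rfl fun l hl => ?_
    rw [Finset.mem_range] at hl
    simp [c, show l ≠ S.q by omega]
  have hlist : S.rightList =
      (List.range (S.q + 1)).flatMap fun r => List.replicate (c r) (S.x (r + 1)) := by
    rw [List.range_succ, List.flatMap_append, rightList]
    congr 1
    · simp only [List.flatMap]
      congr 1
      refine List.map_congr_left fun l hl => ?_
      rw [List.mem_range] at hl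
      simp [c, show l ≠ S.q by omega]
    · simp [c, b]
  obtain ⟨r, hr, h1, h2⟩ := exists_block c (n := S.q + 1) (p := i - 1) (by
    rw [Finset.sum_range_succ, hc _ le_rfl]
    have := S.leftCount_eq le_rfl
    rw [← K_eq] at this
    simp only [c, if_true]
    omega)
  refine ⟨r, by omega, ?_, ?_, fun r' hr' hq => ?_⟩
  · rw [t, hlist, getD_flatMap_replicate c (fun r => S.x (r + 1)) S.b hr h1 h2]
  · rw [hc r (by omega)] at h1; omega
  · have : ∑ l ∈ Finset.range (r + 1), c l ≤ S.rightCount r' := by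
      rw [← hc r' hq]
      exact Finset.sum_le_sum_of_subset (Finset.range_mono hr')
    omega

lemma s_zero : S.s 0 = S.s 1 := rfl

lemma one_le_K : 1 ≤ S.K := (S.leftCount_pos S.q).trans_eq S.K_eq.symm

lemma s_le_x_iff {i r : ℕ} (hK : i ≤ S.K) (hr : r ≤ S.q) : S.s i ≤ S.x r ↔ i ≤ S.leftCount r := by
  wlog hi : 1 ≤ i generalizing i
  · obtain rfl : i = 0 := by omega
    rw [s_zero, this S.one_le_K le_rfl]
    have := S.leftCount_pos r
    omega
  obtain ⟨r₀, hr₀, hs, h1, h2⟩ := S.exists_s_eq hi hK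
  rw [hs, S.x_le_x_iff (by omega) (by omega)]
  constructor
  · intro h
    exact h1.trans (S.leftCount_mono h)
  · intro h
    by_contra hlt
    exact absurd (h2 r (by omega)) (by omega)

lemma x_le_t_iff {i r : ℕ} (hi : 1 ≤ i) (hK : i ≤ S.K) (hr : r ≤ S.q) :
    S.x (r + 1) ≤ S.t i ↔ S.rightCount r < i := by
  obtain ⟨r₀, hr₀, hs, h1, h2⟩ := S.exists_t_eq hi hK
  rw [hs, S.x_le_x_iff (by omega) (by omega)]
  constructor
  · intro h
    exact (S.rightCount_mono (by omega : r ≤ r₀)).trans_lt h1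
  · intro h
    by_contra hlt
    exact absurd (h2 r (by omega) hr) (by omega)

lemma s_le_of_mem_piece_iff {i r : ℕ} {x : ℝ} (hK : i ≤ S.K) (hr : r ≤ S.q)
    (hx : x ∈ S.piece r) : S.s i ≤ x ↔ i ≤ S.leftCount r := by
  wlog hi : 1 ≤ i generalizing i
  · obtain rfl : i = 0 := by omega
    rw [s_zero, this S.one_le_K le_rfl]
    have := S.leftCount_pos r
    omega
  have hxr : S.x r ≤ x := by
    unfold piece at hx
    split_ifs at hx
    · exact hx.1
    · exact hx.1
  constructor
  · intro h
    obtain ⟨r₀, hr₀, hs, h1, h2⟩ := S.exists_s_eq hi hK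
    refine h1.trans (S.leftCount_mono ?_)
    by_contra hlt
    have h3 := S.x_le_x (i := r + 1) (j := r₀) (by omega) (by omega)
    unfold piece at hx
    rw [if_neg (by omega)] at hx
    exact absurd hx.2 (by rw [not_lt]; exact h3.trans (hs ▸ h))
  · intro h
    exact ((S.s_le_x_iff hK hr).2 h).trans hxr

lemma IsDefined.le_and_le_iff {S : MDSpline} {n i r : ℕ} (h : S.IsDefined n i) (hn : n ≤ S.m)
    (hr : r ≤ S.q) :
    (S.s i ≤ S.x r ∧ S.x (r + 1) ≤ S.t (i + n - S.m)) ↔ S.Active n i r := by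
  have h1 := h.1
  have h2 := h.2.1
  rw [S.s_le_x_iff h2 hr, S.x_le_t_iff (by omega) (by omega) hr, Active]
  omega

/-- Both end points are breakpoints, so a nontrivial interval contains a whole piece, namely the one
starting at `s_i`. From here on, supports are handled through `Active` alone. -/
lemma isDefined_iff {n i : ℕ} (hn : n ≤ S.m) :
    S.IsDefined n i ↔ ∃ r ≤ S.q, S.Active n i r := by
  constructor
  · intro h
    have h1 := h.1
    have h2 := h.2.1
    obtain ⟨r, hr, hs, h3, h4⟩ := S.exists_s_eq (i := i) (by omega) h2
    refine ⟨r, hr, (h.le_and_le_iff hn hr).1 ⟨hs.le, ?_⟩⟩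
    obtain ⟨r', hr', ht, -⟩ := S.exists_t_eq (i := i + n - S.m) (by omega) (by omega)
    have h5 := h.2.2
    rw [hs, ht] at h5
    rw [ht]
    refine S.x_le_x ?_ (by omega)
    by_contra hlt
    exact absurd (S.x_le_x (i := r' + 1) (j := r) (by omega) (by omega)) (not_le.2 h5)
  · rintro ⟨r, hr, h1, h2⟩
    have h3 := S.leftCount_le_K hr
    refine ⟨by omega, by omega, ?_⟩
    have h4 := (S.s_le_x_iff (by omega) hr).2 h2
    have h5 := (S.x_le_t_iff (i := i + n - S.m) (by omega) (by omega) hr).2 (by omega)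
    exact h4.trans_lt ((S.x_lt r hr).trans_le h5)

lemma Active.le_add {S : MDSpline} {n i r : ℕ} (h : S.Active n i r) (hr : r ≤ S.q) :
    S.m ≤ n + S.d r := by
  have := S.leftCount_eq hr
  have h1 := h.1
  have h2 := h.2
  omega

/-- In general `n + d r - m + 1` indices are active on the piece; at the starting level just one is
left. -/
lemma active_iff_eq_leftCount {n i r : ℕ} (hr : r ≤ S.q) (hn : n + S.d r = S.m) :
    S.Active n i r ↔ i = S.leftCount r := by
  have := S.leftCount_eq hr
  unfold Active
  omega

lemma mem_piece_left {r : ℕ} {x : ℝ} (hx : x ∈ S.piece r) : S.x r ≤ x := by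
  unfold piece at hx
  split_ifs at hx
  · exact hx.1
  · exact hx.1

lemma mem_piece_right {r : ℕ} {x : ℝ} (hx : x ∈ S.piece r) : x ≤ S.x (r + 1) := by
  unfold piece at hx
  split_ifs at hx
  · exact hx.2
  · exact hx.2.le

lemma Ioo_subset_piece (r : ℕ) : Ioo (S.x r) (S.x (r + 1)) ⊆ S.piece r := by
  unfold piece
  split_ifs
  · exact Ioo_subset_Icc_self
  · exact Ioo_subset_Ico_self

lemma le_of_mem_piece {r r' : ℕ} {x y : ℝ} (hr : r ≤ S.q) (hx : x ∈ S.piece r)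
    (hy : y ∈ S.piece r') (hxy : x ≤ y) : r ≤ r' := by
  by_contra hlt
  have h1 := S.mem_piece_left hx
  have h3 := S.x_le_x (i := r' + 1) (j := r) (by omega) (by omega)
  unfold piece at hy
  rw [if_neg (by omega)] at hy
  exact absurd hy.2 (not_lt.2 (by linarith))

lemma eq_of_mem_piece {r r' : ℕ} {x : ℝ} (hr : r ≤ S.q) (hr' : r' ≤ S.q) (hx : x ∈ S.piece r)
    (hy : x ∈ S.piece r') : r = r' :=
  le_antisymm (S.le_of_mem_piece hr hx hy le_rfl) (S.le_of_mem_piece hr' hy hx le_rfl)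

lemma exists_mem_piece {x : ℝ} (hx : x ∈ Icc S.a S.b) : ∃ r ≤ S.q, x ∈ S.piece r := by
  have key : ∀ n ≤ S.q, x < S.x (n + 1) → ∃ r ≤ n, S.x r ≤ x ∧ x < S.x (r + 1) := by
    intro n
    induction n with
    | zero => exact fun _ h => ⟨0, le_rfl, hx.1, h⟩
    | succ n ih =>
      intro hn h
      by_cases h1 : x < S.x (n + 1)
      · obtain ⟨r, hr, h2⟩ := ih (by omega) h1
        exact ⟨r, by omega, h2⟩
      · exact ⟨n + 1, le_rfl, not_lt.1 h1, h⟩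
  rcases hx.2.eq_or_lt with h | h
  · refine ⟨S.q, le_rfl, ?_⟩
    rw [piece, if_pos rfl, h]
    exact ⟨(S.x_lt S.q le_rfl).le, le_rfl⟩
  · obtain ⟨r, hr, h1, h2⟩ := key S.q le_rfl h
    refine ⟨r, hr, ?_⟩
    unfold piece
    split_ifs
    · exact ⟨h1, h2.le⟩
    · exact ⟨h1, h2⟩

lemma piece_subset {r : ℕ} (hr : r ≤ S.q) : S.piece r ⊆ Icc S.a S.b := fun _ hx =>
  ⟨(S.x_le_x (Nat.zero_le r) (by omega)).trans (S.mem_piece_left hx),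
    (S.mem_piece_right hx).trans (S.x_le_x (by omega) le_rfl)⟩

lemma measurableSet_piece (r : ℕ) : MeasurableSet (S.piece r) := by
  unfold piece
  split_ifs
  · exact measurableSet_Icc
  · exact measurableSet_Ico

end

/-! ### Values, integrability and normalised primitives of the functions `N_{i,n}`. -/

section

variable (S : MDSpline)

/-- The integral of `N_{i,n}`. -/
def mass (n i : ℕ) : ℝ := ∫ u, S.N n i u

/-- The normalised primitive of `N_{i,n}`. -/
def prim (n i : ℕ) : ℝ → ℝ := S.primitive n i (S.N n i)

lemma assemble_of_mem_piece {n i r : ℕ} {x : ℝ} (F : ℝ → ℝ) (hn : n ≤ S.m) (hr : r ≤ S.q)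
    (hx : x ∈ S.piece r) :
    (S.Active n i r → S.assemble n i F x = if n + S.d r = S.m then 1 else F x) ∧
      (¬ S.Active n i r → S.assemble n i F x = 0) := by
  unfold assemble
  by_cases hd : S.IsDefined n i
  · rw [if_pos hd, Finset.sum_eq_single r]
    · constructor
      · intro h
        have h1 := h.le_add hr
        rw [if_pos ⟨hx, (hd.le_and_le_iff hn hr).2 h⟩]
        split_ifs <;> first | rfl | omega
      · intro h
        rw [if_neg fun h1 => h ((hd.le_and_le_iff hn hr).1 h1.2)]
    · intro r' hr' hne
      rw [if_neg]
      intro h1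
      rw [Finset.mem_range] at hr'
      exact hne (S.eq_of_mem_piece (by omega) hr h1.1 hx)
    · intro h
      simp at h
      omega
  · rw [if_neg hd]
    exact ⟨fun h => absurd ((S.isDefined_iff hn).2 ⟨r, hr, h⟩) hd, fun _ => rfl⟩

lemma assemble_of_notMem {n i : ℕ} {x : ℝ} (F : ℝ → ℝ) (hx : x ∉ Icc S.a S.b) :
    S.assemble n i F x = 0 := by
  unfold assemble
  split_ifs
  · refine Finset.sum_eq_zero fun r hr => ?_
    rw [if_neg]
    intro h
    rw [Finset.mem_range] at hr
    exact hx (S.piece_subset (by omega) h.1)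
  · rfl

lemma N_of_notMem {n i : ℕ} {x : ℝ} (hx : x ∉ Icc S.a S.b) : S.N n i x = 0 := by
  cases n <;> exact S.assemble_of_notMem _ hx

lemma N_of_not_active {n i r : ℕ} {x : ℝ} (hn : n ≤ S.m) (hr : r ≤ S.q) (hx : x ∈ S.piece r)
    (h : ¬ S.Active n i r) : S.N n i x = 0 := by
  cases n <;> exact (S.assemble_of_mem_piece _ hn hr hx).2 h

lemma N_of_add_eq {n i r : ℕ} {x : ℝ} (hn : n ≤ S.m) (hr : r ≤ S.q) (hx : x ∈ S.piece r)
    (hd : n + S.d r = S.m) : S.N n i x = if i = S.leftCount r then 1 else 0 := by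
  split_ifs with h
  · rw [← S.active_iff_eq_leftCount (n := n) hr hd] at h
    cases n
    · exact ((S.assemble_of_mem_piece _ hn hr hx).1 h).trans (if_pos hd)
    · exact ((S.assemble_of_mem_piece _ hn hr hx).1 h).trans (if_pos hd)
  · rw [← S.active_iff_eq_leftCount (n := n) hr hd] at h
    exact S.N_of_not_active hn hr hx h

lemma N_succ_of_active {n i r : ℕ} {x : ℝ} (hn : n + 1 ≤ S.m) (hr : r ≤ S.q) (hx : x ∈ S.piece r)
    (hd : S.m ≤ n + S.d r) (h : S.Active (n + 1) i r) :
    S.N (n + 1) i x = S.prim n i x - S.prim n (i + 1) x :=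
  ((S.assemble_of_mem_piece _ hn hr hx).1 h).trans (if_neg (by omega))

lemma N_of_not_isDefined {n i : ℕ} (h : ¬ S.IsDefined n i) : S.N n i = 0 := by
  cases n <;> exact funext fun x => if_neg h

lemma mass_of_not_isDefined {n i : ℕ} (h : ¬ S.IsDefined n i) : S.mass n i = 0 := by
  simp [mass, S.N_of_not_isDefined h]

lemma prim_of_isDefined {n i : ℕ} (h : S.IsDefined n i) (x : ℝ) :
    S.prim n i x = (S.mass n i)⁻¹ * ∫ u in Iic x, S.N n i u := if_pos h

lemma prim_of_not_isDefined {n i r : ℕ} {x : ℝ} (h : ¬ S.IsDefined n i) (hr : r ≤ S.q)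
    (hx : x ∈ S.piece r) : S.prim n i x = if i ≤ S.leftCount r then 1 else 0 := by
  refine (if_neg h).trans ?_
  by_cases hi : i ≤ S.leftCount r
  · have hK := hi.trans (S.leftCount_le_K hr)
    rw [if_pos hi, if_pos ⟨hK, (S.s_le_of_mem_piece_iff hK hr hx).2 hi⟩]
  · rw [if_neg hi, if_neg fun h => hi ((S.s_le_of_mem_piece_iff h.1 hr hx).1 h.2)]

lemma integral_Iic_eq_add {f : ℝ → ℝ} (hf : Integrable f) (x : ℝ) :
    ∫ u in Iic x, f u = (∫ u in Iic (0 : ℝ), f u) + ∫ u in (0 : ℝ)..x, f u := by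
  have := intervalIntegral.integral_Iic_sub_Iic (a := 0) (b := x) hf.integrableOn hf.integrableOn
  linarith

lemma continuous_integral_Iic {f : ℝ → ℝ} (hf : Integrable f) :
    Continuous fun x => ∫ u in Iic x, f u := by
  rw [funext (integral_Iic_eq_add hf)]
  exact continuous_const.add (hf.continuous_primitive 0)

lemma measurable_primitive {n i : ℕ} {f : ℝ → ℝ} (hf : Integrable f) :
    Measurable (S.primitive n i f) := by
  classical
  unfold primitive
  by_cases h : S.IsDefined n i
  · simp only [if_pos h]
    exact ((continuous_integral_Iic hf).measurable).const_mul _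
  · simp only [if_neg h]
    refine Measurable.ite ?_ measurable_const measurable_const
    exact (MeasurableSet.const _).inter (measurableSet_Ici (a := S.s i))

lemma exists_abs_primitive_le {n i : ℕ} {f : ℝ → ℝ} (hf : Integrable f) :
    ∃ C, ∀ x, |S.primitive n i f x| ≤ C := by
  unfold primitive
  by_cases h : S.IsDefined n i
  · refine ⟨|(∫ u, f u)⁻¹| * ∫ u, |f u|, fun x => ?_⟩
    rw [if_pos h, abs_mul]
    refine mul_le_mul_of_nonneg_left ?_ (abs_nonneg _)
    exact abs_integral_le_integral_abs.trans
      (setIntegral_le_integral hf.abs (Filter.Eventually.of_forall fun _ => abs_nonneg _))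
  · refine ⟨1, fun x => ?_⟩
    rw [if_neg h]
    split_ifs <;> simp

lemma integrable_assemble {n i : ℕ} {F : ℝ → ℝ} (hF : Measurable F) {C : ℝ}
    (hC : ∀ x, |F x| ≤ C) : Integrable (S.assemble n i F) := by
  classical
  unfold assemble
  by_cases hd : S.IsDefined n i
  · simp only [if_pos hd]
    refine integrable_finsetSum _ fun r hr => ?_
    have hfin : volume (S.piece r) < ⊤ := by
      rw [Finset.mem_range] at hr
      exact (measure_mono (S.piece_subset (by omega))).trans_lt measure_Icc_lt_top
    have hG : Measurable fun x => if n + S.d r = S.m then (1 : ℝ) else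
        if S.m < n + S.d r then F x else 0 := by
      split_ifs
      · exact measurable_const
      · exact hF
      · exact measurable_const
    have hGC : ∀ x, ‖(if n + S.d r = S.m then (1 : ℝ) else
        if S.m < n + S.d r then F x else 0)‖ ≤ max 1 C := by
      intro x
      split_ifs
      · simp
      · exact (hC x).trans (le_max_right _ _)
      · simp
    by_cases hs : S.s i ≤ S.x r ∧ S.x (r + 1) ≤ S.t (i + n - S.m)
    · have : IntegrableOn (fun x => if n + S.d r = S.m then (1 : ℝ) else
          if S.m < n + S.d r then F x else 0) (S.piece r) :=
        Measure.integrableOn_of_bounded hfin.ne hG.aestronglyMeasurable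
          (Filter.Eventually.of_forall hGC)
      refine ((integrable_indicator_iff (S.measurableSet_piece r)).2 this).congr
        (Filter.Eventually.of_forall fun x => ?_)
      simp only [indicator, hs, and_true]
    · simp [hs]
  · simp [hd]

lemma integrable_N (n i : ℕ) : Integrable (S.N n i) := by
  induction n generalizing i with
  | zero => exact S.integrable_assemble measurable_const (C := 0) (by simp)
  | succ n ih =>
    obtain ⟨C, hC⟩ := S.exists_abs_primitive_le (n := n) (i := i) (ih i)
    obtain ⟨C', hC'⟩ := S.exists_abs_primitive_le (n := n) (i := i + 1) (ih (i + 1))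
    exact S.integrable_assemble
      ((S.measurable_primitive (ih i)).sub (S.measurable_primitive (ih (i + 1))))
      fun x => (abs_sub _ _).trans (add_le_add (hC x) (hC' x))

lemma continuous_prim {n i : ℕ} (h : S.IsDefined n i) : Continuous (S.prim n i) := by
  have : S.prim n i = fun x => (S.mass n i)⁻¹ * ∫ u in Iic x, S.N n i u :=
    funext fun x => S.prim_of_isDefined h x
  rw [this]
  exact continuous_const.mul (continuous_integral_Iic (S.integrable_N n i))

/-- The functions `N_{i,n}` that are not identically zero by convention have positive integral. -/
def PosMass (n : ℕ) : Prop := ∀ i, S.IsDefined n i → 0 < S.mass n i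

lemma prim_eq_zero {n i r : ℕ} {x : ℝ} (hn : n ≤ S.m) (hr : r ≤ S.q) (hx : x ∈ S.piece r)
    (hi : S.leftCount r < i) : S.prim n i x = 0 := by
  by_cases h : S.IsDefined n i
  · rw [S.prim_of_isDefined h, setIntegral_eq_zero_of_forall_eq_zero, mul_zero]
    intro y hy
    by_cases hy' : y ∈ Icc S.a S.b
    · obtain ⟨r', hr', hyr⟩ := S.exists_mem_piece hy'
      refine S.N_of_not_active hn hr' hyr fun hact => ?_
      have := S.leftCount_mono (S.le_of_mem_piece hr' hyr hx hy)
      have := hact.2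
      omega
    · exact S.N_of_notMem hy'
  · rw [S.prim_of_not_isDefined h hr hx, if_neg (by omega)]

/-- The support ends before the piece, so all the mass has been collected; positivity is what makes
the normalisation give `1`. The step-function convention gives the same value in the undefined case.
-/
lemma prim_eq_one {n i r : ℕ} {x : ℝ} (hn : n ≤ S.m) (hr : r ≤ S.q) (hx : x ∈ S.piece r)
    (hpos : S.PosMass n) (hi : i ≤ S.leftCount r) (hi' : i + n ≤ S.rightCount r + S.m) :
    S.prim n i x = 1 := by
  by_cases h : S.IsDefined n i
  · have : ∫ u in Iic x, S.N n i u = S.mass n i := by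
      refine setIntegral_eq_integral_of_forall_compl_eq_zero fun y hy => ?_
      by_cases hy' : y ∈ Icc S.a S.b
      · obtain ⟨r', hr', hyr⟩ := S.exists_mem_piece hy'
        refine S.N_of_not_active hn hr' hyr fun hact => ?_
        have := S.rightCount_mono (S.le_of_mem_piece hr hx hyr (not_le.1 hy).le)
        have := hact.1
        omega
      · exact S.N_of_notMem hy'
    rw [S.prim_of_isDefined h, this, inv_mul_cancel₀ (hpos i h).ne']
  · rw [S.prim_of_not_isDefined h hr hx, if_pos hi]

/-- Outside the support both primitives are `1` or both are `0`, so the cut-off built into the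
definition is automatic and the recurrence may be used for every index. -/
lemma N_succ {n r : ℕ} (i : ℕ) {x : ℝ} (hn : n + 1 ≤ S.m) (hr : r ≤ S.q) (hx : x ∈ S.piece r)
    (hd : S.m ≤ n + S.d r) (hpos : S.PosMass n) :
    S.N (n + 1) i x = S.prim n i x - S.prim n (i + 1) x := by
  by_cases h : S.Active (n + 1) i r
  · exact S.N_succ_of_active hn hr hx hd h
  · rw [S.N_of_not_active hn hr hx h]
    by_cases hi : i ≤ S.leftCount r
    · have h1 : i + 1 + n ≤ S.rightCount r + S.m := by
        by_contra h2
        exact h ⟨by omega, hi⟩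
      have := S.leftCount_eq hr
      rw [S.prim_eq_one (by omega) hr hx hpos hi (by omega),
        S.prim_eq_one (by omega) hr hx hpos (by omega) h1, sub_self]
    · rw [S.prim_eq_zero (by omega) hr hx (by omega), S.prim_eq_zero (by omega) hr hx (by omega),
        sub_self]

lemma continuousOn_prim {n i r : ℕ} (hr : r ≤ S.q) :
    ContinuousOn (S.prim n i) (S.piece r) := by
  by_cases h : S.IsDefined n i
  · exact (S.continuous_prim h).continuousOn
  · exact continuousOn_const.congr fun x hx => S.prim_of_not_isDefined h hr hx

lemma continuousOn_N {n i r : ℕ} (hn : n ≤ S.m) (hr : r ≤ S.q) :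
    ContinuousOn (S.N n i) (S.piece r) := by
  by_cases h : S.Active n i r
  · by_cases hd : n + S.d r = S.m
    · exact continuousOn_const.congr fun x hx => S.N_of_add_eq hn hr hx hd
    · have h1 := h.le_add hr
      cases n with
      | zero => exact absurd (S.d_le_m hr) (by omega)
      | succ n =>
        exact ((S.continuousOn_prim hr).sub (S.continuousOn_prim hr)).congr
          fun x hx => S.N_succ_of_active hn hr hx (by omega) h
  · exact continuousOn_const.congr fun x hx => S.N_of_not_active hn hr hx h

lemma hasDerivAt_prim {n i r : ℕ} {x : ℝ} (hn : n ≤ S.m) (hr : r ≤ S.q) (h : S.IsDefined n i)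
    (hx : x ∈ Ioo (S.x r) (S.x (r + 1))) :
    HasDerivAt (S.prim n i) ((S.mass n i)⁻¹ * S.N n i x) x := by
  have h0 : S.prim n i = fun x => (S.mass n i)⁻¹ *
      ((∫ u in Iic (0 : ℝ), S.N n i u) + ∫ u in (0 : ℝ)..x, S.N n i u) :=
    funext fun x => by rw [S.prim_of_isDefined h, integral_Iic_eq_add (S.integrable_N n i)]
  rw [h0]
  refine HasDerivAt.const_mul _ (HasDerivAt.const_add _ ?_)
  have hO : Ioo (S.x r) (S.x (r + 1)) ∈ nhds x := isOpen_Ioo.mem_nhds hx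
  have hc := (S.continuousOn_N (i := i) hn hr).mono (S.Ioo_subset_piece r)
  exact intervalIntegral.integral_hasDerivAt_right (S.integrable_N n i).intervalIntegrable
    (hc.stronglyMeasurableAtFilter isOpen_Ioo x hx) (hc.continuousAt hO)

end

/-! ### Local linear independence and positivity of masses. -/

section

variable (S : MDSpline)

lemma sum_Ioc_mul_sub (c P : ℕ → ℝ) {L e : ℕ} (h : L + 1 ≤ e) :
    ∑ i ∈ Finset.Ioc L e, c i * (P i - P (i + 1)) =
      c (L + 1) * P (L + 1) + ∑ i ∈ Finset.Ioc (L + 1) e, (c i - c (i - 1)) * P i -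
        c e * P (e + 1) := by
  induction e, h using Nat.le_induction with
  | base => simp; ring
  | succ e he ih =>
    rw [Finset.sum_Ioc_succ_top (by omega), Finset.sum_Ioc_succ_top (by omega), ih]
    simp only [Nat.add_sub_cancel]
    ring

/-- Local linear independence on the `r`-th breakpoint interval. -/
lemma eq_zero_of_sum_eq_zero {n r : ℕ} (hn : n ≤ S.m) (hr : r ≤ S.q)
    (hpos : ∀ n' < n, S.PosMass n') {c : ℕ → ℝ}
    (hc : ∀ x ∈ Ioo (S.x r) (S.x (r + 1)),
      ∑ i ∈ Finset.Ioc (S.rightCount r + S.m - n) (S.leftCount r), c i * S.N n i x = 0)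
    {i : ℕ} (hi : S.Active n i r) : c i = 0 := by
  obtain ⟨x₀, hx₀⟩ := nonempty_Ioo.2 (S.x_lt r hr)
  have hle := S.leftCount_eq hr
  have hdm := S.d_le_m hr
  induction n generalizing c i with
  | zero =>
    have h0 := hi.le_add hr
    have hd : 0 + S.d r = S.m := by omega
    have hi' := (S.active_iff_eq_leftCount hr hd).1 hi
    have := hc x₀ hx₀
    rw [show S.rightCount r + S.m - 0 = i - 1 by omega, show S.leftCount r = i - 1 + 1 by omega,
      Finset.sum_Ioc_succ_top le_rfl, show i - 1 + 1 = i by omega] at this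
    rwa [S.N_of_add_eq hn hr (S.Ioo_subset_piece r hx₀) hd, if_pos hi', Finset.Ioc_self,
      Finset.sum_empty, zero_add, mul_one] at this
  | succ n ih =>
    have h0 := hi.le_add hr
    by_cases hd : n + 1 + S.d r = S.m
    · have hi' := (S.active_iff_eq_leftCount hr hd).1 hi
      have := hc x₀ hx₀
      rw [show S.rightCount r + S.m - (n + 1) = i - 1 by omega,
        show S.leftCount r = i - 1 + 1 by omega,
        Finset.sum_Ioc_succ_top le_rfl, show i - 1 + 1 = i by omega] at this
      rwa [S.N_of_add_eq hn hr (S.Ioo_subset_piece r hx₀) hd, if_pos hi', Finset.Ioc_self,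
        Finset.sum_empty, zero_add, mul_one] at this
    · obtain ⟨L, hL⟩ : ∃ L, L = S.rightCount r + S.m - (n + 1) := ⟨_, rfl⟩
      have hL' : S.rightCount r + S.m - n = L + 1 := by omega
      rw [← hL] at hc
      rw [hL'] at ih
      -- Summation by parts: the first primitive is identically `1` on the piece and the one after
      -- the last is `0`, leaving a constant plus a combination of primitives of the functions
      -- active at level `n`.
      have hf : ∀ x ∈ Ioo (S.x r) (S.x (r + 1)), c (L + 1) +
          ∑ i ∈ Finset.Ioc (L + 1) (S.leftCount r), (c i - c (i - 1)) * S.prim n i x = 0 := by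
        intro x hx
        have hx' := S.Ioo_subset_piece r hx
        have h1 := hc x hx
        simp_rw [S.N_succ _ hn hr hx' (by omega) (hpos n (by omega))] at h1
        rw [sum_Ioc_mul_sub c (fun i => S.prim n i x) (by omega),
          S.prim_eq_one (by omega) hr hx' (hpos n (by omega)) (by omega) (by omega),
          S.prim_eq_zero (by omega) hr hx' (by omega)] at h1
        linarith
      have hact : ∀ i ∈ Finset.Ioc (L + 1) (S.leftCount r), S.Active n i r := by
        intro i hi
        rw [Finset.mem_Ioc] at hi
        exact ⟨by omega, hi.2⟩
      have hstep : ∀ i ∈ Finset.Ioc (L + 1) (S.leftCount r), c i = c (i - 1) := by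
        intro i hi
        have hdef := (S.isDefined_iff (by omega)).2 ⟨r, hr, hact i hi⟩
        -- Differentiating gives a relation at level `n`; the inverse masses come from the
        -- normalisation and are nonzero, so consecutive coefficients coincide.
        have := ih (by omega) (fun n' h => hpos n' (by omega))
          (c := fun i => (c i - c (i - 1)) * (S.mass n i)⁻¹) ?_ (hact i hi)
        · rcases mul_eq_zero.1 this with h | h
          · linarith
          · exact absurd h (inv_ne_zero (hpos n (by omega) i hdef).ne')
        intro x hx
        have h1 : HasDerivAt (fun x => c (L + 1) +
            ∑ i ∈ Finset.Ioc (L + 1) (S.leftCount r), (c i - c (i - 1)) * S.prim n i x)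
            (∑ i ∈ Finset.Ioc (L + 1) (S.leftCount r),
              (c i - c (i - 1)) * ((S.mass n i)⁻¹ * S.N n i x)) x := by
          refine HasDerivAt.const_add _ (HasDerivAt.fun_sum fun i hi => ?_)
          exact (S.hasDerivAt_prim (by omega) hr
            ((S.isDefined_iff (by omega)).2 ⟨r, hr, hact i hi⟩) hx).const_mul _
        have h2 := (hasDerivAt_const x (0 : ℝ)).congr_of_eventuallyEq
          (Filter.eventuallyEq_of_mem (isOpen_Ioo.mem_nhds hx) hf)
        rw [← h1.unique h2]
        exact Finset.sum_congr rfl fun i _ => by ring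
      have hfirst : c (L + 1) = 0 := by
        rw [← hf x₀ hx₀, Finset.sum_eq_zero, add_zero]
        intro i hi
        rw [hstep i hi, sub_self, zero_mul]
      have hall : ∀ p, L + 1 + p ≤ S.leftCount r → c (L + 1 + p) = 0 := by
        intro p
        induction p with
        | zero => exact fun _ => hfirst
        | succ p ihp =>
          intro hp
          rw [hstep _ (Finset.mem_Ioc.2 ⟨by omega, hp⟩)]
          exact ihp (by omega)
      have h1 := hi.1
      have h2 := hi.2
      rw [show i = L + 1 + (i - (L + 1)) by omega]
      exact hall _ (by omega)

/-- Consecutive functions `N_{i,n}`, `N_{i+1,n}` have unique coefficients. -/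
lemma eq_zero_of_pair_eq_zero {n i : ℕ} (hn : n ≤ S.m) (hpos : ∀ n' < n, S.PosMass n') {u v : ℝ}
    (h : ∀ x ∈ Icc S.a S.b, u * S.N n i x + v * S.N n (i + 1) x = 0) :
    (S.IsDefined n i → u = 0) ∧ (S.IsDefined n (i + 1) → v = 0) := by
  -- Indices outside the active range contribute nothing on the piece, so the two-term relation
  -- extends to the full local sum.
  let c : ℕ → ℝ := fun p => if p = i then u else if p = i + 1 then v else 0
  have key : ∀ p, S.IsDefined n p → c p = 0 := by
    intro p hp
    obtain ⟨r, hr, hact⟩ := (S.isDefined_iff hn).1 hp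
    refine S.eq_zero_of_sum_eq_zero hn hr hpos (fun x hx => ?_) hact
    have hx' := S.Ioo_subset_piece r hx
    have hsub : ∀ p, p ∉ Finset.Ioc (S.rightCount r + S.m - n) (S.leftCount r) →
        S.N n p x = 0 := by
      intro p hp
      refine S.N_of_not_active hn hr hx' fun hact => hp ?_
      have h1 := hact.1
      have h2 := hact.2
      rw [Finset.mem_Ioc]
      omega
    have h0 := h x (S.piece_subset hr hx')
    rw [← h0]
    have hterm : ∀ p, c p * S.N n p x =
        (if p = i then u * S.N n i x else 0) + if p = i + 1 then v * S.N n (i + 1) x else 0 := by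
      intro p
      by_cases h1 : p = i
      · subst h1; simp [c]
      · by_cases h2 : p = i + 1
        · subst h2; simp [c]
        · simp [c, h1, h2]
    simp_rw [hterm, Finset.sum_add_distrib, Finset.sum_ite_eq']
    congr 1
    · split_ifs with h1
      · rfl
      · rw [hsub _ h1, mul_zero]
    · split_ifs with h1
      · rfl
      · rw [hsub _ h1, mul_zero]
  exact ⟨fun h => by simpa [c] using key i h, fun h => by simpa [c] using key (i + 1) h⟩

/-- A nonnegative function of zero mass vanishes almost everywhere, hence by continuity throughout
the interior of an active piece, contradicting local linear independence. -/
lemma posMass_of_nonneg {n : ℕ} (hn : n ≤ S.m) (hpos : ∀ n' < n, S.PosMass n')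
    (hN : ∀ i x, 0 ≤ S.N n i x) : S.PosMass n := by
  intro i hi
  refine (integral_nonneg (hN i)).lt_of_ne fun h0 => ?_
  obtain ⟨r, hr, hact⟩ := (S.isDefined_iff hn).1 hi
  have hae := (integral_eq_zero_iff_of_nonneg (hN i) (S.integrable_N n i)).1 h0.symm
  have hzero : EqOn (S.N n i) 0 (Ioo (S.x r) (S.x (r + 1))) :=
    Measure.eqOn_open_of_ae_eq (ae_restrict_of_ae hae) isOpen_Ioo
      ((S.continuousOn_N hn hr).mono (S.Ioo_subset_piece r)) continuousOn_const
  have := S.eq_zero_of_sum_eq_zero hn hr hpos (c := Pi.single i (1 : ℝ)) (fun x hx => ?_) hact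
  · simp at this
  · refine Finset.sum_eq_zero fun p _ => ?_
    by_cases hp : p = i
    · subst hp
      rw [hzero hx]
      simp
    · simp [hp]

end

/-! ### Reverse knot insertion along the recurrence. -/

section

variable (S : MDSpline)

lemma rightCount_insertKnot {j : ℕ} (hj : 1 ≤ j) (hjq : j ≤ S.q) (hk : 1 ≤ S.k j) (r : ℕ) :
    (S.insertKnot j).rightCount r = S.rightCount r + if j ≤ r then 1 else 0 := by
  induction r with
  | zero => rw [rightCount_zero, rightCount_zero, if_neg (by omega)]
  | succ r ih =>
    rw [rightCount_succ, rightCount_succ, ih]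
    change _ + (S.d r - Function.update S.k j (S.k j - 1) (r + 1)) = _
    by_cases h : r + 1 = j
    · have := S.k_succ_le (r := r) (by omega)
      rw [← h] at hk
      rw [← h, Function.update_self, if_neg (by omega), if_pos le_rfl]
      omega
    · rw [Function.update_of_ne h]
      split_ifs <;> omega

lemma leftCount_insertKnot {j : ℕ} (hj : 1 ≤ j) (hjq : j ≤ S.q) (hk : 1 ≤ S.k j) (r : ℕ) :
    (S.insertKnot j).leftCount r = S.leftCount r + if j ≤ r then 1 else 0 := by
  induction r with
  | zero =>
    rw [if_neg (by omega)]
    simp [leftCount, insertKnot]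
  | succ r ih =>
    rw [leftCount_succ, leftCount_succ, ih]
    change _ + (S.d (r + 1) - Function.update S.k j (S.k j - 1) (r + 1)) = _
    by_cases h : r + 1 = j
    · have := S.k_succ_le (r := r) (by omega)
      rw [← h] at hk
      rw [← h, Function.update_self, if_neg (by omega), if_pos le_rfl]
      omega
    · rw [Function.update_of_ne h]
      split_ifs <;> omega

open Classical in
/-- The coefficients of reverse knot insertion at level `n` of the integral recurrence. -/
def rkiCoeff (j : ℕ) : ℕ → ℕ → ℝ
  | 0, i => if i ≤ S.leftCount (j - 1) then 1 else 0
  | n + 1, i =>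
    if S.IsDefined n i then rkiCoeff j n i * (S.insertKnot j).mass n i / S.mass n i
    else if i ≤ S.leftCount (j - 1) then 1 else 0

variable {S} {j : ℕ}

lemma rkiCoeff_eq_zero {n i : ℕ} (hi : S.leftCount (j - 1) < i) : S.rkiCoeff j n i = 0 := by
  induction n with
  | zero => exact if_neg (by omega)
  | succ n ih =>
    rw [rkiCoeff, ih, zero_mul, zero_div, if_neg (not_le.2 hi), ite_self]


lemma active_insertKnot (hj : 1 ≤ j) (hjq : j ≤ S.q) (hk : 1 ≤ S.k j) {n i r : ℕ} :
    (S.insertKnot j).Active n i r ↔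
      S.rightCount r + (if j ≤ r then 1 else 0) + S.m < i + n ∧
        i ≤ S.leftCount r + if j ≤ r then 1 else 0 := by
  unfold Active
  rw [S.rightCount_insertKnot hj hjq hk, S.leftCount_insertKnot hj hjq hk]
  rfl

/-- Lowering the continuity at `x j` shrinks supports: `N̂_i` for indices up to `leftCount (j - 1)`,
and `N̂_{i+1}` for `i` from there on, live inside the support of `N_i`. -/
lemma active_of_active_insertKnot (hj : 1 ≤ j) (hjq : j ≤ S.q) (hk : 1 ≤ S.k j) {n i r : ℕ}
    (hi : i ≤ S.leftCount (j - 1)) (h : (S.insertKnot j).Active n i r) : S.Active n i r := by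
  rw [active_insertKnot hj hjq hk] at h
  split_ifs at h with hr
  · have := S.leftCount_mono (show j - 1 ≤ r by omega)
    exact ⟨by omega, by omega⟩
  · exact ⟨by omega, by omega⟩

lemma active_of_active_insertKnot_succ (hj : 1 ≤ j) (hjq : j ≤ S.q) (hk : 1 ≤ S.k j) {n i r : ℕ}
    (hi : S.leftCount (j - 1) ≤ i) (h : (S.insertKnot j).Active n (i + 1) r) :
    S.Active n i r ∧ j ≤ r := by
  rw [active_insertKnot hj hjq hk] at h
  split_ifs at h with hr
  · exact ⟨⟨by omega, by omega⟩, hr⟩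
  · have := S.leftCount_mono (show r ≤ j - 1 by omega)
    omega

/-- Reverse knot insertion at level `n`. -/
def Rki (S : MDSpline) (j n : ℕ) : Prop := ∀ i x, S.N n i x =
  S.rkiCoeff j n i * (S.insertKnot j).N n i x +
    (1 - S.rkiCoeff j n (i + 1)) * (S.insertKnot j).N n (i + 1) x

lemma Rki.mass_eq {n : ℕ} (h : S.Rki j n) (i : ℕ) : S.mass n i =
    S.rkiCoeff j n i * (S.insertKnot j).mass n i +
      (1 - S.rkiCoeff j n (i + 1)) * (S.insertKnot j).mass n (i + 1) := by
  unfold mass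
  rw [funext (h i), integral_add (((S.insertKnot j).integrable_N n i).const_mul _)
    (((S.insertKnot j).integrable_N n (i + 1)).const_mul _), integral_const_mul,
    integral_const_mul]

lemma Rki.integral_Iic_eq {n : ℕ} (h : S.Rki j n) (i : ℕ) (x : ℝ) :
    ∫ u in Iic x, S.N n i u =
      S.rkiCoeff j n i * (∫ u in Iic x, (S.insertKnot j).N n i u) +
        (1 - S.rkiCoeff j n (i + 1)) * ∫ u in Iic x, (S.insertKnot j).N n (i + 1) u := by
  rw [funext (h i), integral_add (((S.insertKnot j).integrable_N n i).const_mul _).integrableOn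
    (((S.insertKnot j).integrable_N n (i + 1)).const_mul _).integrableOn, integral_const_mul,
    integral_const_mul]

lemma PosMass.mass_mul_prim {n : ℕ} (hpos : S.PosMass n) (i : ℕ) (x : ℝ) :
    S.mass n i * S.prim n i x = ∫ u in Iic x, S.N n i u := by
  by_cases h : S.IsDefined n i
  · rw [S.prim_of_isDefined h, mul_inv_cancel_left₀ (hpos i h).ne']
  · simp [S.mass_of_not_isDefined h, S.N_of_not_isDefined h]

/-- Reverse knot insertion for the normalised primitives. -/
lemma Rki.prim_eq (hj : 1 ≤ j) (hjq : j ≤ S.q) (hk : 1 ≤ S.k j) {n : ℕ} (hn : n ≤ S.m)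
    (h : S.Rki j n) (hpos : S.PosMass n) (hpos' : (S.insertKnot j).PosMass n) (i : ℕ) {r : ℕ}
    (hr : r ≤ S.q) {x : ℝ} (hx : x ∈ S.piece r) :
    S.prim n i x = S.rkiCoeff j (n + 1) i * (S.insertKnot j).prim n i x +
      (1 - S.rkiCoeff j (n + 1) i) * (S.insertKnot j).prim n (i + 1) x := by
  by_cases hd : S.IsDefined n i
  · have hne := (hpos i hd).ne'
    have h1 := h.mass_eq i
    have h2 := h.integral_Iic_eq i x
    -- The product form stays valid when a hatted function is undefined, since its mass is then
    -- zero. Eliminating the second mass with `h1` turns its weight into `1 - α'_i`.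
    rw [← hpos'.mass_mul_prim, ← hpos'.mass_mul_prim, ← hpos.mass_mul_prim] at h2
    rw [rkiCoeff, if_pos hd]
    field_simp
    linear_combination h2 - (S.insertKnot j).prim n (i + 1) x * h1
  · rw [S.prim_of_not_isDefined hd hr hx, rkiCoeff, if_neg hd]
    -- If `N_{i,n}` is undefined, so is `N̂_{i,n}` or `N̂_{i+1,n}`, according to the side of `x j`;
    -- the coefficient `1` or `0` selects that one, whose step function is the same.
    by_cases hi : i ≤ S.leftCount (j - 1)
    · have hd' : ¬ (S.insertKnot j).IsDefined n i := fun h' => by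
        obtain ⟨r, hr, hact⟩ := ((S.insertKnot j).isDefined_iff hn).1 h'
        exact hd ((S.isDefined_iff hn).2 ⟨r, hr, active_of_active_insertKnot hj hjq hk hi hact⟩)
      rw [if_pos hi, (S.insertKnot j).prim_of_not_isDefined hd' hr hx,
        S.leftCount_insertKnot hj hjq hk, sub_self, zero_mul, one_mul, add_zero]
      refine if_congr ?_ rfl rfl
      split_ifs with hjr
      · have := S.leftCount_mono (show j - 1 ≤ r by omega)
        omega
      · omega
    · have hd' : ¬ (S.insertKnot j).IsDefined n (i + 1) := fun h' => by
        obtain ⟨r, hr, hact⟩ := ((S.insertKnot j).isDefined_iff hn).1 h'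
        exact hd ((S.isDefined_iff hn).2
          ⟨r, hr, (active_of_active_insertKnot_succ hj hjq hk (by omega) hact).1⟩)
      rw [if_neg hi, (S.insertKnot j).prim_of_not_isDefined hd' hr hx,
        S.leftCount_insertKnot hj hjq hk, sub_zero, zero_mul, one_mul, zero_add]
      refine if_congr ?_ rfl rfl
      split_ifs with hjr
      · omega
      · have := S.leftCount_mono (show r ≤ j - 1 by omega)
        omega

/-- The coefficients are one for the functions that do not extend far enough beyond `x j`. -/
def CoeffOne (S : MDSpline) (j n : ℕ) : Prop := ∀ i, i ≤ S.leftCount (j - 1) →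
  i + n ≤ S.rightCount j + S.m + 1 → S.rkiCoeff j n i = 1

/-- At the starting level of a piece only one function is nonzero, with index shifted by one in the
hatted space when the piece lies right of `x j`. Matching therefore needs a coefficient `1` on the
left and `0` on the right. -/
lemma rki_of_add_le (hj : 1 ≤ j) (hjq : j ≤ S.q) (hk : 1 ≤ S.k j) {n : ℕ} (hn : n ≤ S.m)
    (hone : S.CoeffOne j n) (i : ℕ) {r : ℕ} (hr : r ≤ S.q) {x : ℝ} (hx : x ∈ S.piece r)
    (hd : n + S.d r ≤ S.m) : S.N n i x =
      S.rkiCoeff j n i * (S.insertKnot j).N n i x +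
        (1 - S.rkiCoeff j n (i + 1)) * (S.insertKnot j).N n (i + 1) x := by
  have hle := S.leftCount_eq hr
  rcases hd.eq_or_lt with hd | hd
  · rw [S.N_of_add_eq hn hr hx hd, (S.insertKnot j).N_of_add_eq hn hr hx hd,
      (S.insertKnot j).N_of_add_eq hn hr hx hd, S.leftCount_insertKnot hj hjq hk]
    by_cases hjr : j ≤ r
    · have := S.leftCount_mono (show j - 1 ≤ r by omega)
      simp only [if_pos hjr, Nat.add_right_cancel_iff]
      by_cases h1 : i = S.leftCount r
      · rw [if_pos h1, if_neg (by omega), rkiCoeff_eq_zero (i := i + 1) (by omega)]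
        ring
      · rw [if_neg h1]
        by_cases h2 : i = S.leftCount r + 1
        · rw [rkiCoeff_eq_zero (i := i) (by omega)]
          ring
        · rw [if_neg h2]
          ring
    · have h3 := S.leftCount_mono (show r ≤ j - 1 by omega)
      have h4 := S.rightCount_mono (show r ≤ j by omega)
      simp only [if_neg hjr, add_zero]
      by_cases h1 : i = S.leftCount r
      · rw [if_pos h1, if_neg (by omega), hone i (by omega) (by omega)]
        ring
      · rw [if_neg h1]
        by_cases h2 : i + 1 = S.leftCount r
        · rw [hone (i + 1) (by omega) (by omega)]
          ring
        · rw [if_neg h2]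
          ring
  · have hna : ∀ i, ¬ (S.insertKnot j).Active n i r := fun i h => by
      have : S.m ≤ n + S.d r := h.le_add hr
      omega
    rw [S.N_of_not_active hn hr hx fun h => by have := h.le_add hr; omega,
      (S.insertKnot j).N_of_not_active hn hr hx (hna _),
      (S.insertKnot j).N_of_not_active hn hr hx (hna _)]
    ring

lemma rki_of_forall_piece {n : ℕ} (h : ∀ i, ∀ r ≤ S.q, ∀ x ∈ S.piece r, S.N n i x =
      S.rkiCoeff j n i * (S.insertKnot j).N n i x +
        (1 - S.rkiCoeff j n (i + 1)) * (S.insertKnot j).N n (i + 1) x) : S.Rki j n := by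
  intro i x
  by_cases hx : x ∈ Icc S.a S.b
  · obtain ⟨r, hr, hxr⟩ := S.exists_mem_piece hx
    exact h i r hr x hxr
  · rw [S.N_of_notMem hx, (S.insertKnot j).N_of_notMem hx, (S.insertKnot j).N_of_notMem hx]
    ring

lemma coeffOne_zero : S.CoeffOne j 0 := fun _ hi _ => if_pos hi

lemma rki_zero (hj : 1 ≤ j) (hjq : j ≤ S.q) (hk : 1 ≤ S.k j) : S.Rki j 0 :=
  rki_of_forall_piece fun i r hr x hx =>
    rki_of_add_le hj hjq hk (Nat.zero_le _) coeffOne_zero i hr hx (by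
      have := S.d_le_m hr
      omega)

/-- In the mass identity the second term drops out, because its coefficient is `0` or `N̂_{i+1,n}`
is undefined; the quotient of masses defining the next coefficient is then `1`. -/
lemma coeffOne_succ (hj : 1 ≤ j) (hjq : j ≤ S.q) (hk : 1 ≤ S.k j) {n : ℕ} (hn : n ≤ S.m)
    (h : S.Rki j n) (hpos : S.PosMass n) (hone : S.CoeffOne j n) : S.CoeffOne j (n + 1) := by
  intro i hi hin
  rw [rkiCoeff, if_pos hi]
  split_ifs with hd
  · have h1 := h.mass_eq i
    have h2 : (1 - S.rkiCoeff j n (i + 1)) * (S.insertKnot j).mass n (i + 1) = 0 := by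
      by_cases hi' : i + 1 ≤ S.leftCount (j - 1)
      · rw [hone _ hi' (by omega), sub_self, zero_mul]
      · rw [(S.insertKnot j).mass_of_not_isDefined, mul_zero]
        intro hd'
        obtain ⟨r, hr, hact⟩ := ((S.insertKnot j).isDefined_iff hn).1 hd'
        obtain ⟨h3, hjr⟩ := active_of_active_insertKnot_succ hj hjq hk (by omega) hact
        rw [active_insertKnot hj hjq hk, if_pos hjr] at hact
        have := S.rightCount_mono hjr
        omega
    rw [h2, add_zero] at h1
    rw [← h1, div_self (hpos i hd).ne']
  · rfl

lemma rki_succ (hj : 1 ≤ j) (hjq : j ≤ S.q) (hk : 1 ≤ S.k j) {n : ℕ} (hn : n + 1 ≤ S.m)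
    (h : S.Rki j n) (hpos : S.PosMass n) (hpos' : (S.insertKnot j).PosMass n)
    (hone : S.CoeffOne j n) : S.Rki j (n + 1) := by
  refine rki_of_forall_piece fun i r hr x hx => ?_
  by_cases hd : n + 1 + S.d r ≤ S.m
  · exact rki_of_add_le hj hjq hk hn (coeffOne_succ hj hjq hk (by omega) h hpos hone) i hr hx hd
  · rw [S.N_succ i hn hr hx (by omega) hpos,
      (S.insertKnot j).N_succ i hn hr hx (show S.m ≤ n + S.d r by omega) hpos',
      (S.insertKnot j).N_succ (i + 1) hn hr hx (show S.m ≤ n + S.d r by omega) hpos',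
      h.prim_eq hj hjq hk (by omega) hpos hpos' i hr hx,
      h.prim_eq hj hjq hk (by omega) hpos hpos' (i + 1) hr hx]
    ring

lemma Rki.nonneg {n : ℕ} (h : S.Rki j n) (hc : ∀ i, S.rkiCoeff j n i ∈ Icc 0 1)
    (hN : ∀ i x, 0 ≤ (S.insertKnot j).N n i x) (i : ℕ) (x : ℝ) : 0 ≤ S.N n i x := by
  rw [h i x]
  exact add_nonneg (mul_nonneg (hc i).1 (hN _ _))
    (mul_nonneg (sub_nonneg.2 (hc (i + 1)).2) (hN _ _))

/-- The new coefficient is the share of one nonnegative term in the mass identity. -/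
lemma rkiCoeff_mem_Icc_succ {n : ℕ} (h : S.Rki j n) (hc : ∀ i, S.rkiCoeff j n i ∈ Icc 0 1)
    (hpos : S.PosMass n) (hN : ∀ i x, 0 ≤ (S.insertKnot j).N n i x) (i : ℕ) :
    S.rkiCoeff j (n + 1) i ∈ Icc 0 1 := by
  have hm : ∀ i, 0 ≤ (S.insertKnot j).mass n i := fun i => integral_nonneg (hN i)
  rw [rkiCoeff]
  split_ifs with hd
  · have h1 := mul_nonneg (hc i).1 (hm i)
    have h2 := mul_nonneg (sub_nonneg.2 (hc (i + 1)).2) (hm (i + 1))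
    refine ⟨div_nonneg h1 (hpos i hd).le, div_le_one_of_le₀ ?_ (hpos i hd).le⟩
    rw [h.mass_eq i]
    linarith
  · simp
  · simp

/-- All functions `N_{i,n}` with `n < m` are nonnegative. -/
def Nonneg (S : MDSpline) : Prop := ∀ n < S.m, ∀ i x, 0 ≤ S.N n i x

lemma Nonneg.posMass (h : S.Nonneg) {n : ℕ} (hn : n < S.m) : S.PosMass n := by
  induction n using Nat.strong_induction_on with
  | _ n ih => exact S.posMass_of_nonneg hn.le (fun n' hn' => ih n' hn' (hn'.trans hn)) (h n hn)

lemma rki_aux (hj : 1 ≤ j) (hjq : j ≤ S.q) (hk : 1 ≤ S.k j) (hN : (S.insertKnot j).Nonneg)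
    {n : ℕ} (hn : n ≤ S.m) : S.Rki j n ∧ S.CoeffOne j n ∧ (∀ i, S.rkiCoeff j n i ∈ Icc 0 1) ∧
      ∀ n' < n, S.PosMass n' := by
  induction n with
  | zero =>
    refine ⟨rki_zero hj hjq hk, coeffOne_zero, fun i => ?_, by simp⟩
    rw [rkiCoeff]
    split_ifs <;> simp
  | succ n ih =>
    obtain ⟨h1, h2, h3, h4⟩ := ih (by omega)
    have h5 := hN n hn
    have h6 : S.PosMass n := S.posMass_of_nonneg (by omega) h4 (h1.nonneg h3 h5)
    refine ⟨rki_succ hj hjq hk hn h1 h6 (hN.posMass hn) h2,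
      coeffOne_succ hj hjq hk (by omega) h1 h6 h2, rkiCoeff_mem_Icc_succ h1 h3 h6 h5,
      fun n' hn' => ?_⟩
    rcases Nat.lt_succ_iff_lt_or_eq.1 hn' with h | rfl
    · exact h4 n' h
    · exact h6

lemma nonneg_of_insertKnot (hj : 1 ≤ j) (hjq : j ≤ S.q) (hk : 1 ≤ S.k j)
    (hN : (S.insertKnot j).Nonneg) : S.Nonneg := fun n hn =>
  have h := rki_aux hj hjq hk hN hn.le
  h.1.nonneg h.2.2.1 (hN n hn)

end

/-! ### Nonnegativity: Bernstein polynomials as the base case, then induction on the continuities.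
-/

section

variable (S : MDSpline)

/-- The normalised primitive on `[0, 1]` of the Bernstein polynomial of degree `g` and index `c`. -/
def bernsteinPrim (g c : ℕ) : Polynomial ℝ :=
  ∑ ν ∈ Finset.Ioc c (g + 1), bernsteinPolynomial ℝ (g + 1) ν

/-- Each derivative is a difference of consecutive Bernstein polynomials of degree `g`, so the sum
telescopes, and its upper end vanishes because the index exceeds the degree. -/
lemma derivative_bernsteinPrim {g c : ℕ} (hc : c ≤ g) :
    Polynomial.derivative (bernsteinPrim g c) = (g + 1) * bernsteinPolynomial ℝ g c := by
  have key : ∀ p, Polynomial.derivative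
      (∑ ν ∈ Finset.Ioc c (c + p), bernsteinPolynomial ℝ (g + 1) ν) =
        (g + 1) * (bernsteinPolynomial ℝ g c - bernsteinPolynomial ℝ g (c + p)) := by
    intro p
    induction p with
    | zero => simp
    | succ p ih =>
      rw [← add_assoc, Finset.sum_Ioc_succ_top (by omega), Polynomial.derivative_add, ih,
        bernsteinPolynomial.derivative_succ]
      push_cast
      ring
  have := key (g + 1 - c)
  rwa [show c + (g + 1 - c) = g + 1 by omega, bernsteinPolynomial.eq_zero_of_lt ℝ (Nat.lt_succ_self g),
    sub_zero] at this

lemma bernsteinPrim_eval_zero (g c : ℕ) : (bernsteinPrim g c).eval 0 = 0 := by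
  rw [bernsteinPrim, Polynomial.eval_finsetSum]
  refine Finset.sum_eq_zero fun ν hν => ?_
  rw [Finset.mem_Ioc] at hν
  rw [bernsteinPolynomial.eval_at_0, if_neg (by omega)]

lemma bernsteinPrim_eval_one {g c : ℕ} (hc : c ≤ g) : (bernsteinPrim g c).eval 1 = 1 := by
  rw [bernsteinPrim, Polynomial.eval_finsetSum]
  simp_rw [bernsteinPolynomial.eval_at_1]
  rw [Finset.sum_ite_eq', if_pos (Finset.mem_Ioc.2 ⟨by omega, le_rfl⟩)]

lemma bernsteinPrim_sub {g c : ℕ} (hc : c ≤ g) :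
    bernsteinPrim g c - bernsteinPrim g (c + 1) = bernsteinPolynomial ℝ (g + 1) (c + 1) := by
  rw [bernsteinPrim, bernsteinPrim, sub_eq_iff_eq_add, ← Finset.sum_Ioc_consecutive _
    (Nat.le_succ c) (by omega : c + 1 ≤ g + 1)]
  simp

lemma one_sub_bernsteinPrim (g : ℕ) :
    1 - bernsteinPrim g 0 = bernsteinPolynomial ℝ (g + 1) 0 := by
  rw [bernsteinPrim, sub_eq_iff_eq_add, ← bernsteinPolynomial.sum ℝ (g + 1),
    Finset.sum_range_succ', add_comm, Finset.range_eq_Ico, Finset.sum_Ico_add' _ 0 (g + 1) 1]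
  congr 1

lemma bernsteinPrim_self (g : ℕ) : bernsteinPrim g (g + 1) = 0 := by simp [bernsteinPrim]

lemma bernsteinPolynomial_eval_nonneg (g c : ℕ) {u : ℝ} (hu : u ∈ Icc 0 1) :
    0 ≤ (bernsteinPolynomial ℝ g c).eval u := by
  have h1 := hu.1
  have h2 := sub_nonneg.2 hu.2
  simp only [bernsteinPolynomial, Polynomial.eval_mul, Polynomial.eval_natCast,
    Polynomial.eval_pow, Polynomial.eval_X, Polynomial.eval_sub, Polynomial.eval_one]
  positivity

/-- The affine coordinate on the `r`-th breakpoint interval. -/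
def coord (r : ℕ) (x : ℝ) : ℝ := (x - S.x r) / (S.x (r + 1) - S.x r)

lemma coord_mem_Icc {r : ℕ} (hr : r ≤ S.q) {x : ℝ} (hx : x ∈ S.piece r) :
    S.coord r x ∈ Icc 0 1 := by
  have h := sub_pos.2 (S.x_lt r hr)
  have h1 := S.mem_piece_left hx
  have h2 := S.mem_piece_right hx
  exact ⟨div_nonneg (by linarith) h.le, (div_le_one h).2 (by linarith)⟩

lemma integral_bernsteinPolynomial_coord {r g c : ℕ} (hr : r ≤ S.q) (hc : c ≤ g) (x : ℝ) :
    ∫ y in S.x r..x, (bernsteinPolynomial ℝ g c).eval (S.coord r y) =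
      (S.x (r + 1) - S.x r) / (g + 1) * (bernsteinPrim g c).eval (S.coord r x) := by
  have h := (sub_pos.2 (S.x_lt r hr)).ne'
  have hg : (g + 1 : ℝ) ≠ 0 := by positivity
  have hcoord : ∀ y, HasDerivAt (S.coord r) (1 / (S.x (r + 1) - S.x r)) y := fun y =>
    ((hasDerivAt_id y).sub_const _).div_const _
  have hderiv : ∀ y, HasDerivAt (fun y => (S.x (r + 1) - S.x r) / (g + 1) *
      (bernsteinPrim g c).eval (S.coord r y))
      ((bernsteinPolynomial ℝ g c).eval (S.coord r y)) y := by
    intro y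
    have h1 := (((bernsteinPrim g c).hasDerivAt (S.coord r y)).comp y (hcoord y)).const_mul
      ((S.x (r + 1) - S.x r) / (g + 1))
    refine h1.congr_deriv ?_
    rw [derivative_bernsteinPrim hc]
    simp only [Polynomial.eval_mul, Polynomial.eval_add, Polynomial.eval_natCast,
      Polynomial.eval_one]
    field_simp
  have hcont : Continuous (S.coord r) :=
    continuous_iff_continuousAt.2 fun y => (hcoord y).continuousAt
  rw [intervalIntegral.integral_eq_sub_of_hasDerivAt (fun y _ => hderiv y)
    (((bernsteinPolynomial ℝ g c).continuous.comp hcont).intervalIntegrable _ _),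
    show S.coord r (S.x r) = 0 by simp [coord], bernsteinPrim_eval_zero, mul_zero, sub_zero]

lemma integral_Iic_N_eq {n i r g c : ℕ} (hr : r ≤ S.q) (hc : c ≤ g)
    (hN : ∀ y ∈ S.piece r, S.N n i y = (bernsteinPolynomial ℝ g c).eval (S.coord r y))
    (hN' : ∀ y ∉ S.piece r, S.N n i y = 0) {x : ℝ} (hx : x ∈ Icc (S.x r) (S.x (r + 1))) :
    ∫ u in Iic x, S.N n i u =
      (S.x (r + 1) - S.x r) / (g + 1) * (bernsteinPrim g c).eval (S.coord r x) := by
  rw [← S.integral_bernsteinPolynomial_coord hr hc x]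
  have h1 := intervalIntegral.integral_Iic_sub_Iic (a := S.x r) (b := x)
    (S.integrable_N n i).integrableOn (S.integrable_N n i).integrableOn
  have h2 : ∫ u in Iic (S.x r), S.N n i u = 0 := by
    rw [integral_Iic_eq_integral_Iio]
    exact setIntegral_eq_zero_of_forall_eq_zero fun y hy =>
      hN' y fun h => absurd (S.mem_piece_left h) (not_le.2 hy)
  rw [h2, sub_zero] at h1
  rw [h1]
  refine intervalIntegral.integral_congr_ae ?_
  -- Pieces are half-open except the last, so the right end point is discarded as a null set.
  filter_upwards [Measure.ae_ne volume (S.x (r + 1))] with y hy hyx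
  rw [uIoc_of_le hx.1] at hyx
  exact hN y (S.Ioo_subset_piece r ⟨hyx.1, lt_of_le_of_ne (hyx.2.trans hx.2) hy⟩)

lemma mass_eq_of_bernstein {n i r g c : ℕ} (hr : r ≤ S.q) (hc : c ≤ g)
    (hN : ∀ y ∈ S.piece r, S.N n i y = (bernsteinPolynomial ℝ g c).eval (S.coord r y))
    (hN' : ∀ y ∉ S.piece r, S.N n i y = 0) :
    S.mass n i = (S.x (r + 1) - S.x r) / (g + 1) := by
  have h := (sub_pos.2 (S.x_lt r hr))
  have h1 := S.integral_Iic_N_eq hr hc hN hN' (x := S.x (r + 1)) ⟨(S.x_lt r hr).le, le_rfl⟩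
  rw [show S.coord r (S.x (r + 1)) = 1 from div_self h.ne', bernsteinPrim_eval_one hc,
    mul_one] at h1
  rw [← h1]
  refine (setIntegral_eq_integral_of_forall_compl_eq_zero fun y hy => ?_).symm
  exact hN' y fun h => hy (S.mem_piece_right h)

variable {S}

/-- With mere continuity at the breakpoints, only functions of the top level `m` can straddle one;
this is why `n < m` is required here and in `Nonneg`. -/
lemma Active.eq_of_k_eq_zero (hk : ∀ i, 1 ≤ i → i ≤ S.q → S.k i = 0) {n i r r' : ℕ}
    (hn : n < S.m) (hr : r ≤ S.q) (hr' : r' ≤ S.q) (h : S.Active n i r) (h' : S.Active n i r') :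
    r = r' := by
  wlog hlt : r < r' generalizing r r'
  · by_contra hne
    exact hne (this hr' hr h' h (by omega)).symm
  have h1 := S.leftCount_eq hr
  have h2 := S.rightCount_mono (show r + 1 ≤ r' by omega)
  have h3 := S.rightCount_succ r
  rw [hk (r + 1) (by omega) (by omega)] at h3
  have h4 := h.2
  have h5 := h'.1
  omega

lemma N_eq_zero_of_notMem_piece (hk : ∀ i, 1 ≤ i → i ≤ S.q → S.k i = 0) {n i r : ℕ}
    (hn : n < S.m) (hr : r ≤ S.q) (h : S.Active n i r) {y : ℝ} (hy : y ∉ S.piece r) :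
    S.N n i y = 0 := by
  by_cases hy' : y ∈ Icc S.a S.b
  · obtain ⟨r', hr', hyr⟩ := S.exists_mem_piece hy'
    refine S.N_of_not_active hn.le hr' hyr fun h' => hy ?_
    rwa [h.eq_of_k_eq_zero hk hn hr hr' h']
  · exact S.N_of_notMem hy'

lemma N_eq_bernstein_of_add_eq {n : ℕ} (hn : n ≤ S.m) {i r : ℕ} (hr : r ≤ S.q)
    (h : S.Active n i r) (hd : n + S.d r = S.m) {x : ℝ} (hx : x ∈ S.piece r) :
    S.N n i x = (bernsteinPolynomial ℝ (n + S.d r - S.m)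
      (i + n - (S.rightCount r + S.m + 1))).eval (S.coord r x) := by
  have hi := (S.active_iff_eq_leftCount hr hd).1 h
  have := S.leftCount_eq hr
  rw [S.N_of_add_eq hn hr hx hd, if_pos hi, show n + S.d r - S.m = 0 by omega,
    show i + n - (S.rightCount r + S.m + 1) = 0 by omega]
  simp [bernsteinPolynomial]

/-- Each function lives on one piece, where the recurrence becomes the integral recurrence of the
Bernstein basis: degree `n + d r - m`, with index counted from the first active one. At that first
index the left primitive is the constant `1`. -/
lemma N_eq_bernstein (hk : ∀ i, 1 ≤ i → i ≤ S.q → S.k i = 0) {n : ℕ} (hn : n < S.m) {i r : ℕ}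
    (hr : r ≤ S.q) (h : S.Active n i r) {x : ℝ} (hx : x ∈ S.piece r) :
    S.N n i x = (bernsteinPolynomial ℝ (n + S.d r - S.m)
      (i + n - (S.rightCount r + S.m + 1))).eval (S.coord r x) := by
  induction n generalizing i r x with
  | zero =>
    have := h.le_add hr
    have := S.d_le_m hr
    exact N_eq_bernstein_of_add_eq hn.le hr h (by omega) hx
  | succ n ih =>
    have h0 := h.le_add hr
    by_cases hd : n + 1 + S.d r = S.m
    · exact N_eq_bernstein_of_add_eq hn.le hr h hd hx
    have hle := S.leftCount_eq hr
    have h1 := h.1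
    have h2 := h.2
    have hmass : ∀ i r, r ≤ S.q → S.Active n i r →
        S.mass n i = (S.x (r + 1) - S.x r) / ((n + S.d r - S.m : ℕ) + 1) := fun i r hr hi => by
      have h3 := S.leftCount_eq hr
      have h4 := hi.2
      exact S.mass_eq_of_bernstein hr (by omega) (fun y hy => ih (by omega) hr hi hy)
        fun y hy => N_eq_zero_of_notMem_piece hk (by omega) hr hi hy
    have hpos : S.PosMass n := fun i hi => by
      obtain ⟨r, hr, hact⟩ := (S.isDefined_iff (by omega)).1 hi
      rw [hmass i r hr hact]
      exact div_pos (sub_pos.2 (S.x_lt r hr)) (by positivity)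
    obtain ⟨g, hg⟩ : ∃ g, g = n + S.d r - S.m := ⟨_, rfl⟩
    have hprim : ∀ i, S.Active n i r → S.prim n i x =
        (bernsteinPrim g (i + n - (S.rightCount r + S.m + 1))).eval (S.coord r x) := by
      intro i hi
      have h3 := hi.2
      have hc : i + n - (S.rightCount r + S.m + 1) ≤ g := by omega
      have hh := (sub_pos.2 (S.x_lt r hr)).ne'
      rw [S.prim_of_isDefined ((S.isDefined_iff (by omega)).2 ⟨r, hr, hi⟩),
        hmass i r hr hi, ← hg, S.integral_Iic_N_eq hr hc
          (fun y hy => hg ▸ ih (by omega) hr hi hy)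
          (fun y hy => N_eq_zero_of_notMem_piece hk (by omega) hr hi hy) ⟨S.mem_piece_left hx, S.mem_piece_right hx⟩,
        inv_mul_cancel_left₀ (div_ne_zero hh (by positivity))]
    obtain ⟨c, hc⟩ : ∃ c, c = i + n - (S.rightCount r + S.m) := ⟨_, rfl⟩
    have hnext : S.prim n (i + 1) x = (bernsteinPrim g c).eval (S.coord r x) := by
      by_cases hi : i + 1 ≤ S.leftCount r
      · rw [hprim (i + 1) ⟨by omega, hi⟩]
        congr 2
        omega
      · rw [S.prim_eq_zero (by omega) hr hx (by omega), show c = g + 1 by omega,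
          bernsteinPrim_self, Polynomial.eval_zero]
    rw [S.N_succ_of_active (by omega) hr hx (by omega) h, hnext,
      show n + 1 + S.d r - S.m = g + 1 by omega,
      show i + (n + 1) - (S.rightCount r + S.m + 1) = c by omega]
    by_cases hact : S.Active n i r
    · have h3 := hact.1
      obtain ⟨c', rfl⟩ : ∃ c', c = c' + 1 := ⟨c - 1, by omega⟩
      rw [hprim i hact, show i + n - (S.rightCount r + S.m + 1) = c' by omega,
        ← Polynomial.eval_sub, bernsteinPrim_sub (by omega)]
    · have hin : i + n ≤ S.rightCount r + S.m := by
        by_contra h3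
        exact hact ⟨by omega, h2⟩
      obtain rfl : c = 0 := by omega
      rw [← one_sub_bernsteinPrim, Polynomial.eval_sub, Polynomial.eval_one,
        S.prim_eq_one (by omega) hr hx hpos h2 hin]

lemma nonneg_of_k_eq_zero (hk : ∀ i, 1 ≤ i → i ≤ S.q → S.k i = 0) : S.Nonneg := by
  intro n hn i x
  by_cases hx : x ∈ Icc S.a S.b
  · obtain ⟨r, hr, hxr⟩ := S.exists_mem_piece hx
    by_cases h : S.Active n i r
    · rw [N_eq_bernstein hk hn hr h hxr]
      exact bernsteinPolynomial_eval_nonneg _ _ (S.coord_mem_Icc hr hxr)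
    · exact (S.N_of_not_active hn.le hr hxr h).ge
  · exact (S.N_of_notMem hx).ge

/-- Induction on the sum of all continuities; `insertKnot` at a breakpoint of positive continuity
lowers it by one. -/
theorem nonneg (S : MDSpline) : S.Nonneg := by
  obtain ⟨p, hp⟩ : ∃ p, p = ∑ i ∈ Finset.Icc 1 S.q, S.k i := ⟨_, rfl⟩
  induction p generalizing S with
  | zero =>
    refine nonneg_of_k_eq_zero fun i h1 h2 => ?_
    exact Finset.sum_eq_zero_iff.1 hp.symm i (Finset.mem_Icc.2 ⟨h1, h2⟩)
  | succ p ih =>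
    obtain ⟨j, hj, hk⟩ := Finset.exists_ne_zero_of_sum_ne_zero
      (show ∑ i ∈ Finset.Icc 1 S.q, S.k i ≠ 0 by omega)
    rw [Finset.mem_Icc] at hj
    refine nonneg_of_insertKnot hj.1 hj.2 (Nat.one_le_iff_ne_zero.2 hk) (ih _ ?_)
    change p = ∑ i ∈ Finset.Icc 1 S.q, Function.update S.k j (S.k j - 1) i
    rw [Finset.sum_update_of_mem (Finset.mem_Icc.2 hj)]
    rw [← Finset.add_sum_erase _ _ (Finset.mem_Icc.2 hj), Finset.erase_eq] at hp
    omega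

end

/-! ### The levels `m` and `m - 1`: uniqueness of the coefficients. -/

section

variable {S : MDSpline}

/-- The piece starting at `s_i` is active: the preceding left count is below `i`, and `k ≤ d` bounds
the right count by it with one unit to spare, which is what level `m - 1` costs. -/
lemma isDefined_of_pred_le {n i : ℕ} (hn : n ≤ S.m) (hi : S.m + 1 ≤ i + n) (hnm : S.m ≤ n + 1)
    (hK : i ≤ S.K) : S.IsDefined n i := by
  obtain ⟨r, hr, hs, h1, h2⟩ := S.exists_s_eq (i := i) (by omega) hK
  refine (S.isDefined_iff hn).2 ⟨r, hr, ?_, h1⟩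
  cases r with
  | zero => rw [rightCount_zero]; omega
  | succ r =>
    have h3 := h2 r (by omega)
    have h4 := S.leftCount_eq (r := r) (by omega)
    have h5 := S.rightCount_succ r
    omega

lemma K_insertKnot {j : ℕ} (hj : 1 ≤ j) (hjq : j ≤ S.q) (hk : 1 ≤ S.k j) :
    (S.insertKnot j).K = S.K + 1 := by
  rw [K_eq, K_eq, S.leftCount_insertKnot hj hjq hk]
  exact congrArg _ (if_pos hjq)

lemma intervalIntegral_N (n i : ℕ) : ∫ x in S.a..S.b, S.N n i x = S.mass n i := by
  rw [intervalIntegral.integral_of_le (show S.a ≤ S.b from S.x_le_x (Nat.zero_le _) le_rfl),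
    ← integral_Icc_eq_integral_Ioc]
  exact setIntegral_eq_integral_of_forall_compl_eq_zero fun x hx => S.N_of_notMem hx

/-- Reverse knot insertion coefficients at the levels `m` and `m - 1` are those of the integral
recurrence. -/
lemma IsRKICoeff.eq_rkiCoeff {j r : ℕ} (hj : 1 ≤ j) (hjq : j ≤ S.q) (hk : 1 ≤ S.k j) (hr : r ≤ 1)
    {α : ℕ → ℝ} (h : S.IsRKICoeff j r α) {i : ℕ} (hi : 1 ≤ i) (hiK : i ≤ S.K - r) :
    α i = S.rkiCoeff j (S.m - r) (r + i) ∧ α (i + 1) = S.rkiCoeff j (S.m - r) (r + i + 1) := by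
  have hm : 1 ≤ S.m := by
    have := (S.k_le j hj hjq).trans (min_le_right _ _)
    have := S.d_le_m hjq
    omega
  obtain ⟨hrki, -⟩ := rki_aux hj hjq hk (S.insertKnot j).nonneg (Nat.sub_le S.m r)
  have hK := S.K_insertKnot hj hjq hk
  have hdef : ∀ i', r + 1 ≤ i' → i' ≤ S.K + 1 → (S.insertKnot j).IsDefined (S.m - r) i' := by
    intro i' h1 h2
    refine isDefined_of_pred_le (Nat.sub_le S.m r) ?_ ?_ (by omega)
    · change S.m + 1 ≤ _
      omega
    · change S.m ≤ _
      omega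
  have h0 := (S.insertKnot j).eq_zero_of_pair_eq_zero (n := S.m - r) (i := r + i)
    (u := α i - S.rkiCoeff j (S.m - r) (r + i))
    (v := S.rkiCoeff j (S.m - r) (r + i + 1) - α (i + 1)) (Nat.sub_le S.m r)
    (fun n' hn' => (S.insertKnot j).nonneg.posMass (hn'.trans_le (Nat.sub_le S.m r)))
    (fun x hx => by
      have h1 := h i hi hiK x hx
      have h2 := hrki (r + i) x
      change S.N (S.m - r) (r + i) x = α i * (S.insertKnot j).N (S.m - r) (r + i) x +
        (1 - α (i + 1)) * (S.insertKnot j).N (S.m - r) (r + i + 1) x at h1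
      linear_combination h2 - h1)
  have h1 := h0.1 (hdef _ (by omega) (by omega))
  have h2 := h0.2 (hdef _ (by omega) (by omega))
  exact ⟨by linarith, by linarith⟩

lemma isRKICoeff_rkiCoeff {j r : ℕ} (hj : 1 ≤ j) (hjq : j ≤ S.q) (hk : 1 ≤ S.k j) :
    S.IsRKICoeff j r fun i => S.rkiCoeff j (S.m - r) (r + i) := fun i _ _ x _ =>
  (rki_aux hj hjq hk (S.insertKnot j).nonneg (Nat.sub_le S.m r)).1 (r + i) x

lemma eq_leftCount_of_s_le {j l : ℕ} (hjq : j ≤ S.q) (hlK : l ≤ S.K)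
    (hl : S.s l ≤ S.x j ∧ S.x j < min (S.s (l + 1)) S.b) : l = S.leftCount j := by
  refine le_antisymm ((S.s_le_x_iff hlK hjq).1 hl.1) ?_
  by_contra hlt
  have := S.leftCount_le_K hjq
  exact absurd ((S.s_le_x_iff (by omega) hjq).2 (by omega : l + 1 ≤ S.leftCount j))
    (not_le.2 (hl.2.trans_le (min_le_left _ _)))

end

end MDSpline

end

theorem mainTheorem3 (S : MDSpline) (j : ℕ) (hj1 : 1 ≤ j) (hjq : j ≤ S.q) (hkj : 1 ≤ S.k j)
    (l : ℕ) (hl1 : 1 ≤ l) (hlK : l ≤ S.K)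
    (hl : S.s l ≤ S.x j ∧ S.x j < min (S.s (l + 1)) S.b) :
    (∃ α : ℕ → ℝ, S.IsRKICoeff j 0 α) ∧
    (∃ α₁ : ℕ → ℝ, S.IsRKICoeff j 1 α₁) ∧
    ∀ α α₁ : ℕ → ℝ, S.IsRKICoeff j 0 α → S.IsRKICoeff j 1 α₁ →
      (∀ i : ℕ, l + 1 ≤ i + S.d j → i + S.d j ≤ l + S.k j →
        0 < ∫ x in S.a..S.b, S.basis 1 (i - 1) x ∧
        α i = α₁ (i - 1) *
          ((∫ x in S.a..S.b, (S.insertKnot j).basis 1 (i - 1) x) /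
            ∫ x in S.a..S.b, S.basis 1 (i - 1) x) ∧
        1 - α i = (1 - α₁ i) *
          ((∫ x in S.a..S.b, (S.insertKnot j).basis 1 i x) /
            ∫ x in S.a..S.b, S.basis 1 (i - 1) x)) ∧
      (S.k j = 1 → ∀ i : ℕ, 1 ≤ i → i ≤ S.K → α₁ i = 0 ∨ α₁ i = 1) := by
  refine ⟨⟨_, MDSpline.isRKICoeff_rkiCoeff hj1 hjq hkj⟩,
    ⟨_, MDSpline.isRKICoeff_rkiCoeff hj1 hjq hkj⟩, fun α α₁ hα hα₁ => ?_⟩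
  have hlj := MDSpline.eq_leftCount_of_s_le hjq hlK hl
  have hkd := S.k_le j hj1 hjq
  rw [le_min_iff] at hkd
  have hm := S.d_le_m hjq
  have hle := S.leftCount_eq hjq
  have hle' := S.leftCount_eq (r := j - 1) (by omega)
  have hrc : S.rightCount j = S.rightCount (j - 1) + (S.d (j - 1) - S.k j) := by
    have := S.rightCount_succ (j - 1)
    rwa [Nat.sub_add_cancel hj1] at this
  have hK := S.leftCount_le_K hjq
  have hK' := S.leftCount_le_K (r := j - 1) (by omega)
  obtain ⟨n, hn⟩ : ∃ n, S.m = n + 1 := ⟨S.m - 1, by omega⟩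
  have hmn : S.m - 1 = n := by omega
  obtain ⟨hrki, hone, -⟩ :=
    MDSpline.rki_aux hj1 hjq hkj (S.insertKnot j).nonneg (n := n) (by omega)
  have hα₁' : ∀ i, 1 ≤ i → i ≤ S.K → α₁ i = S.rkiCoeff j n (i + 1) := by
    intro i h1 h2
    -- The last coefficient `α₁ K` occurs only as the second one in an identity and `α₁ 1` only as
    -- the first.
    by_cases hi : i = 1
    · have := (hα₁.eq_rkiCoeff hj1 hjq hkj le_rfl (i := i) h1 (by omega)).1
      rwa [hmn, add_comm 1 i] at this
    · have := (hα₁.eq_rkiCoeff hj1 hjq hkj le_rfl (i := i - 1) (by omega) (by omega)).2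
      rwa [hmn, show i - 1 + 1 = i by omega, show 1 + (i - 1) + 1 = i + 1 by omega] at this
  refine ⟨fun i h1 h2 => ?_, fun hk1 i h1 h2 => ?_⟩
  · have e1 : ∫ x in S.a..S.b, S.basis 1 (i - 1) x = S.mass n i := by
      rw [← MDSpline.intervalIntegral_N, MDSpline.basis, hmn, show 1 + (i - 1) = i by omega]
    have e2 : ∫ x in S.a..S.b, (S.insertKnot j).basis 1 (i - 1) x =
        (S.insertKnot j).mass n i := by
      rw [← MDSpline.intervalIntegral_N, MDSpline.basis, show (S.insertKnot j).m - 1 = n from hmn,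
        show 1 + (i - 1) = i by omega]
      rfl
    have e3 : ∫ x in S.a..S.b, (S.insertKnot j).basis 1 i x =
        (S.insertKnot j).mass n (i + 1) := by
      rw [← MDSpline.intervalIntegral_N, MDSpline.basis, show (S.insertKnot j).m - 1 = n from hmn,
        add_comm 1 i]
      rfl
    have hd : S.IsDefined n i :=
      MDSpline.isDefined_of_pred_le (by omega) (by omega) (by omega) (by omega)
    have hpos := S.nonneg.posMass (n := n) (by omega) i hd
    have hαi : α i = S.rkiCoeff j n i * (S.insertKnot j).mass n i / S.mass n i := by
      have := (hα.eq_rkiCoeff hj1 hjq hkj zero_le_one (i := i) (by omega) (by omega)).1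
      rwa [Nat.sub_zero, zero_add, hn, MDSpline.rkiCoeff, if_pos hd] at this
    have hmass := hrki.mass_eq i
    rw [e1, e2, e3, hα₁' (i - 1) (by omega) (by omega), hα₁' i (by omega) (by omega),
      show i - 1 + 1 = i by omega, hαi]
    refine ⟨hpos, mul_div_assoc _ _ _, ?_⟩
    field_simp
    -- The second formula is the mass identity at level `m - 1`, after clearing the denominator.
    linarith
  · rw [hα₁' i h1 h2]
    -- For `k j = 1` one has `leftCount (j - 1) = rightCount j + 2`, so the two conditions of
    -- `CoeffOne` at level `m - 1` coincide and no index lies between the ones and the zeros.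
    by_cases hi : i + 1 ≤ S.leftCount (j - 1)
    · exact Or.inr (hone _ hi (by omega))
    · exact Or.inl (MDSpline.rkiCoeff_eq_zero (by omega))
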